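/- Let $(G,P)$ be a weak quasi-lattice ordered group: $G$ is a group and $P\subseteq G$ is a submonoid with $P\cap P^{-1}=\{e\}$ such that any $p,q\in P$ with $pP\cap qP\neq\emptyset$ have a (unique) least common right multiple $p\vee q\in P$, i.e. $pP\cap qP=(p\vee q)P$. For a finite set $K\subseteq P$ let $\vee K\in P$ denote its least common right multiple if it has one, and write $\vee K=\infty$ otherwise. Assume that $P$ is Noetherian, i.e. there is no infinite sequence $(p_n)$ in $P$ such that each $p_{n+1}$ is a proper factor of $p_n$ (meaning $p_n=g\,p_{n+1}h$ with $g,h\in P$ not both invertible in $P$). Let $P_{\mathrm{inf}}$ be the smallest subset of $P$ that contains all atoms of $P$ and contains $x^{-1}(x\vee p)$ whenever it contains $p$, $x$ is an atom and $x\vee p\ne\infty$. Let $A$ be a $C^*$-algebra, $X=\{X_p\}_{p\in P}$ a compactly aligned product system over $P$ of essential $C^*$-correspondences over $A$ with $X_e=A$, $N:P\to(0,\infty)$ a multiplicative homomorphism, and $\beta\in\mathbb R$. For a tracial state $\tau$ on $A$, $p\in P$ and $a\in A_+$ let $$\operatorname{Tr}_\tau^p(a)=\sup_H\sum_{\xi\in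 H}\tau(\langle\xi,a\xi\rangle)\in[0,\infty],$$ the supremum being over the finite subsets $H\subseteq X_p$ with $\sum_{\xi\in H}\theta_{\xi,\xi}\le 1$, where $\theta_{\xi,\zeta}\eta=\xi\langle\zeta,\eta\rangle$. Then a tracial state $\tau$ on $A$ satisfies $$\tau(a)+\sum_{\emptyset\neq K\subseteq J}(-1)^{|K|}N(\vee K)^{-\beta}\operatorname{Tr}_\tau^{\vee K}(a)\ \ge\ 0\qquad\text{for all }a\in A_+$$ for all finite $J\subseteq P\setminus\{e\}$ if and only if it satisfies this inequality for all finite $J\subseteq P_{\mathrm{inf}}$. Here the terms with $\vee K=\infty$ are zero, and the sums are taken in $[-\infty,\infty]$ with $\infty-\infty=-\infty$. -/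

import Mathlib

open scoped ComplexOrder

noncomputable section

/-! ### Monoids: right LCMs, Noetherianity, the minimal set

In a monoid, Mathlib's `p ∣ q` means `∃ c, q = p * c`: the element `p` is a left divisor of `q`,
i.e. `q` lies in the right ideal generated by `p`. -/

section Monoids

variable {M : Type*} [Monoid M]

/-- `r` is a least common right multiple of the set `U`. -/
def IsRightLCM (U : Set M) (r : M) : Prop :=
  (∀ u ∈ U, u ∣ r) ∧ ∀ r' : M, (∀ u ∈ U, u ∣ r') → r ∣ r'

/-- `p` is a proper factor of `q`. -/
def IsProperFactor (p q : M) : Prop :=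
  ∃ g h : M, q = g * p * h ∧ (¬ IsUnit g ∨ ¬ IsUnit h)

variable (M) in
/-- There is no infinite descending sequence for the proper factor relation. -/
def IsNoetherianMonoid : Prop :=
  ¬ ∃ f : ℕ → M, ∀ n, IsProperFactor (f (n + 1)) (f n)

/-- Membership in the minimal set: the smallest subset that contains the atoms
(irreducible elements) and is closed under `p ↦ x⁻¹ (x ∨ p)` for atoms `x`
such that `x ∨ p` exists.  The element `r` below is `x⁻¹ (x ∨ p)`. -/
inductive MemPInf : M → Prop
  | atom (s : M) : Irreducible s → MemPInf s
  | step (x p r : M) : Irreducible x → MemPInf p → IsRightLCM {x, p} (x * r) → MemPInf r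

variable (M) in
/-- The minimal set. -/
def PInf : Set M := {p | MemPInf p}

end Monoids

/-- `(G, P)` is a weak quasi-lattice ordered group. -/
structure IsWeakQuasiLatticeOrdered {G : Type*} [Group G] (P : Submonoid G) : Prop where
  inter_inv : ∀ g : G, g ∈ P → g⁻¹ ∈ P → g = 1
  exists_lcm : ∀ p q : P, (∃ r : P, p ∣ r ∧ q ∣ r) → ∃ r : P, IsRightLCM {p, q} r

/-! ### Hilbert modules and correspondences -/

/-- A right Hilbert module over a (possibly non-unital) C*-algebra, with inner product `ip` linear
in the second variable.  (Mathlib's `CStarModule` is about left modules.) -/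
class RightHilbertModule (A E : Type*) [NonUnitalCStarAlgebra A] [PartialOrder A]
    [NormedAddCommGroup E] [NormedSpace ℂ E] [CompleteSpace E] where
  ip : E → E → A
  /-- the right action, `ract x a = x a` -/
  ract : E →ₗ[ℂ] A →ₗ[ℂ] E
  ract_mul : ∀ (x : E) (a b : A), ract x (a * b) = ract (ract x a) b
  ip_add_right : ∀ x y z : E, ip x (y + z) = ip x y + ip x z
  ip_smul_right : ∀ (c : ℂ) (x y : E), ip x (c • y) = c • ip x y
  ip_ract_right : ∀ (x y : E) (a : A), ip x (ract y a) = ip x y * a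
  star_ip : ∀ x y : E, star (ip x y) = ip y x
  ip_self_nonneg : ∀ x : E, 0 ≤ ip x x
  norm_sq_eq : ∀ x : E, ‖x‖ ^ 2 = ‖ip x x‖

/-- A C*-correspondence over `A`: a right Hilbert `A`-module with a left action of `A` by
a *-homomorphism into the adjointable operators. -/
class CStarCorrespondence (A E : Type*) [NonUnitalCStarAlgebra A] [PartialOrder A]
    [NormedAddCommGroup E] [NormedSpace ℂ E] [CompleteSpace E]
    extends RightHilbertModule A E where
  /-- the left action, `lact a x = φ(a) x` -/
  lact : A →ₗ[ℂ] E →ₗ[ℂ] E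
  lact_mul : ∀ (a b : A) (x : E), lact (a * b) x = lact a (lact b x)
  ip_lact_left : ∀ (a : A) (x y : E), ip (lact a x) y = ip x (lact (star a) y)

open RightHilbertModule CStarCorrespondence

section Modules

variable (A : Type*) [NonUnitalCStarAlgebra A] [PartialOrder A]
  {E : Type*} [NormedAddCommGroup E] [NormedSpace ℂ E] [CompleteSpace E]

/-- The operator `θ_{ξ,ζ} η = ξ ⟨ζ, η⟩`. -/
def theta [RightHilbertModule A E] (ξ ζ η : E) : E := ract ξ (ip ζ η : A)

/-- `T` is adjointable. -/
def IsAdjointable [RightHilbertModule A E] (T : E → E) : Prop :=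
  ∃ S : E → E, ∀ x y : E, (ip (T x) y : A) = ip x (S y)

variable (E) in
/-- The generalised compact operators: the norm closure of the linear span of the `θ_{ξ,ζ}`. -/
def compactOps [RightHilbertModule A E] : Submodule ℂ (E →L[ℂ] E) :=
  (Submodule.span ℂ {T : E →L[ℂ] E | ∃ ξ ζ : E, ∀ η, T η = theta A ξ ζ η}).topologicalClosure

/-- The order of operators on a Hilbert module: `S - T` is positive, that is,
`⟨η, T η⟩ ≤ ⟨η, S η⟩` for all `η`. -/
def OpLE [RightHilbertModule A E] (T S : E → E) : Prop :=
  ∀ η : E, (ip η (T η) : A) ≤ ip η (S η)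

variable (E) in
/-- The correspondence is essential: `φ(A) E` spans a dense subspace. -/
def IsEssential [CStarCorrespondence A E] : Prop :=
  Dense (Submodule.span ℂ {y : E | ∃ (a : A) (x : E), y = lact a x} : Set E)

variable {A} in
/-- The trace `Tr_τ(T) = sup_H ∑_{ξ ∈ H} τ(⟨ξ, T ξ⟩)` induced from `τ`, for positive `T`;
the supremum is over the finite sets `H` with `∑_{ξ ∈ H} θ_{ξ,ξ} ≤ 1`. -/
def inducedTrace [RightHilbertModule A E] (τ : A →L[ℂ] ℂ) (T : E → E) : ENNReal :=
  ⨆ H : {H : Finset E // OpLE A (fun η => ∑ ξ ∈ H, theta A ξ ξ η) (fun η => η)},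
    ENNReal.ofReal (∑ ξ ∈ H.1, (τ (ip ξ (T ξ))).re)

/-- The bilinear map `m : E × F → Y` extends to an isometric isomorphism of the internal tensor
product `E ⊗_A F`, whose inner product is `⟨ξ ⊗ ζ, ξ' ⊗ ζ'⟩ = ⟨ζ, φ(⟨ξ, ξ'⟩) ζ'⟩`, onto `Y`. -/
structure IsInternalTensor {F Y : Type*}
    [NormedAddCommGroup F] [NormedSpace ℂ F] [CompleteSpace F]
    [NormedAddCommGroup Y] [NormedSpace ℂ Y] [CompleteSpace Y]
    [CStarCorrespondence A E] [CStarCorrespondence A F] [CStarCorrespondence A Y]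
    (m : E →ₗ[ℂ] F →ₗ[ℂ] Y) : Prop where
  ip_eq : ∀ (ξ ξ' : E) (ζ ζ' : F),
    (ip (m ξ ζ) (m ξ' ζ') : A) = ip ζ (lact (ip ξ ξ' : A) ζ')
  dense_span : Dense (Submodule.span ℂ {y : Y | ∃ (ξ : E) (ζ : F), y = m ξ ζ} : Set Y)

end Modules

/-- `τ` is a tracial state. -/
structure IsTracialState {A : Type*} [NonUnitalCStarAlgebra A] [PartialOrder A]
    (τ : A →L[ℂ] ℂ) : Prop where
  nonneg : ∀ a : A, 0 ≤ a → 0 ≤ τ a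
  norm_eq_one : ‖τ‖ = 1
  tracial : ∀ a b : A, τ (a * b) = τ (b * a)

/-! ### Product systems -/

section ProductSystems

variable (A : Type*) [NonUnitalCStarAlgebra A] [PartialOrder A]
  {M : Type*} [Monoid M]
  (X : M → Type*) [∀ p, NormedAddCommGroup (X p)] [∀ p, NormedSpace ℂ (X p)]
  [∀ p, CompleteSpace (X p)] [∀ p, CStarCorrespondence A (X p)]

/-- A product system structure on the family `X` of correspondences over `A`, indexed by
a monoid.  The product `X_p × X_q → X_r` is indexed by the proof of `p q = r`, so that no
transport between fibres is needed. -/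
structure ProductSystem where
  mul : ∀ {p q r : M}, p * q = r → (X p →ₗ[ℂ] X q →ₗ[ℂ] X r)
  mul_assoc : ∀ {p q r pq qr s : M} (h₁ : p * q = pq) (h₂ : pq * r = s)
    (h₃ : q * r = qr) (h₄ : p * qr = s) (x : X p) (y : X q) (z : X r),
    mul h₂ (mul h₁ x y) z = mul h₄ x (mul h₃ y z)
  isTensor : ∀ {p q r : M} (h : p * q = r), p ≠ 1 → IsInternalTensor A (mul h)
  /-- the identification of `X_e` with the canonical correspondence `A` over `A` -/
  unit : A ≃ₗ[ℂ] X 1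
  ip_unit : ∀ a b : A, ip (unit a) (unit b) = star a * b
  ract_unit : ∀ a b : A, ract (unit a) b = unit (a * b)
  lact_unit : ∀ a b : A, lact a (unit b) = unit (a * b)
  unit_mul : ∀ (p : M) (a : A) (x : X p), mul (one_mul p) (unit a) x = lact a x
  mul_unit : ∀ (p : M) (x : X p) (a : A), mul (mul_one p) x (unit a) = ract x a

variable {A X}

/-- `S' = ι_p^r(S)`, i.e. `S' = S ⊗ I` on `X_r = X_p ⊗_A X_s`, where `r = p s`.  Such an `S'` is
unique, the products being total in `X_r`. -/
def ProductSystem.IsAmplification (Y : ProductSystem A X) {p s r : M} (h : p * s = r)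
    (S : X p →L[ℂ] X p) (S' : X r →L[ℂ] X r) : Prop :=
  IsAdjointable A S' ∧ ∀ (ξ : X p) (ζ : X s), S' (Y.mul h ξ ζ) = Y.mul h (S ξ) ζ

/-- `ι_p^r(K(X_p)) ι_q^r(K(X_q)) ⊆ K(X_r)` whenever `r = p ∨ q` (here `r = p s = q t`). -/
def ProductSystem.IsCompactlyAligned (Y : ProductSystem A X) : Prop :=
  ∀ (p q r s t : M) (hs : p * s = r) (ht : q * t = r), IsRightLCM {p, q} r →
    ∀ S ∈ compactOps A (X p), ∀ T ∈ compactOps A (X q), ∀ S' T' : X r →L[ℂ] X r,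
      Y.IsAmplification hs S S' → Y.IsAmplification ht T T' →
        S'.comp T' ∈ compactOps A (X r)

/-! ### The positivity condition -/

open Classical in
variable (X) in
/-- `N(∨K)^{-β} Tr_τ^{∨K}(a)`, read as `0` when `∨K = ∞`. -/
def joinTerm (N : M →* ℝ) (β : ℝ) (τ : A →L[ℂ] ℂ) (a : A) (K : Finset M) : ENNReal :=
  if h : ∃ r : M, IsRightLCM (K : Set M) r then
    ENNReal.ofReal (N h.choose ^ (-β)) *
      inducedTrace τ (fun ξ : X h.choose => lact a ξ)
  else 0

variable (X) in
/-- The expression `τ(a) + ∑_{∅ ≠ K ⊆ J} (-1)^{|K|} N(∨K)^{-β} Tr_τ^{∨K}(a)` for `a ≥ 0`.  Induced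
traces may be infinite a priori, so the sum is taken in the extended reals (`∞ - ∞` is `-∞`
there, so an infinite negative term makes the expression negative). -/
def positivitySum (N : M →* ℝ) (β : ℝ) (τ : A →L[ℂ] ℂ) (J : Finset M) (a : A) : EReal :=
  (((τ a).re : ℝ) : EReal) +
    ∑ K ∈ J.powerset with K.Nonempty, (-1 : EReal) ^ K.card * (joinTerm X N β τ a K : EReal)

variable (X) in
/-- The positivity condition for all finite subsets `J` of `R` and all `a ≥ 0`. -/
def PositivityOn (N : M →* ℝ) (β : ℝ) (τ : A →L[ℂ] ℂ) (R : Set M) : Prop :=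
  ∀ J : Finset M, (J : Set M) ⊆ R → ∀ a : A, 0 ≤ a → 0 ≤ positivitySum X N β τ J a

end ProductSystems

end

/-!
For a trace `τ` on `A`, let `N(p)^{-β} Tr_τ^p` be the weight of the right ideal `pP`. Ideals `pP`
and `qP` meet either in `(p ∨ q)P` or not at all, so the sum over `K ⊆ J` is the inclusion–exclusion
expression for the weight of the complement of `⋃_{p ∈ J} pP`.

To bring an arbitrary `J` down to `P_inf`, peel an atom `x` off an element `p = xq` of `J`.
Replacing `pP` by `xP` shrinks the complement by the weight of `xP` outside `xqP` and the other
`yP`. Shifting that difference back by `x` replaces `p` by its proper factor `q` and each `y` by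
`x⁻¹(x ∨ y)`, which stays in `P_inf` if `y` was there. Noetherian induction then gives positivity
for all `J`.

The shift is harmless because `Tr^{xq}` is `Tr^q` followed by `Tr^x` (induction of traces in
stages), and `Tr^x` preserves positivity: it is a limit of the positive functionals
`a ↦ ∑ τ(⟨ξ, a ξ⟩)` along frames of `X_x` that are approximately complete. Positivity for `J = {x}`
with `x` an atom says `N(x)^{-β} Tr_τ^x ≤ τ`, which makes all the traces involved finite.
-/

open RightHilbertModule CStarCorrespondence
open Filter Topology
open scoped ENNReal NNReal

section Phases

variable {E : Type*} [NormedAddCommGroup E] [NormedSpace ℂ E]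

/-- A function on a complex vector space that vanishes at `0` and ignores unimodular factors. Sums
of such functions do not distinguish finite families of vectors from finite sets of vectors. -/
structure PhaseInvariant {B : Type*} [Zero B] (f : E → B) : Prop where
  map_zero : f 0 = 0
  map_smul : ∀ c : ℂ, ‖c‖ = 1 → ∀ x, f (c • x) = f x

theorem exists_norm_eq_one_smul_notMem {ζ : E} (hζ : ζ ≠ 0) (H : Finset E) :
    ∃ c : ℂ, ‖c‖ = 1 ∧ c • ζ ∉ H := by
  have hcircle : (Metric.sphere (0 : ℂ) 1).Infinite :=
    (isPreconnected_sphere (by simp [Complex.rank_real_complex]) 0 1).infinite_of_nontrivial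
      ⟨1, by simp, -1, by simp, by norm_num⟩
  have hray : ((· • ζ) '' Metric.sphere (0 : ℂ) 1).Infinite :=
    hcircle.image (smul_left_injective ℂ hζ).injOn
  obtain ⟨_, ⟨c, hc, rfl⟩, hcH⟩ := hray.exists_notMem_finset H
  exact ⟨c, by simpa using hc, hcH⟩

theorem exists_finset_sum_eq (B : Type*) [AddCommMonoid B] {ι : Type*} (s : Finset ι) (v : ι → E) :
    ∃ H : Finset E, ∀ f : E → B, PhaseInvariant f → ∑ ξ ∈ H, f ξ = ∑ i ∈ s, f (v i) := by
  classical
  induction s using Finset.induction_on with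
  | empty => exact ⟨∅, fun f _ => by simp⟩
  | insert i s hi ih =>
    obtain ⟨H, hH⟩ := ih
    by_cases hv : v i = 0
    · exact ⟨H, fun f hf => by rw [Finset.sum_insert hi, hv, hf.map_zero, zero_add, hH f hf]⟩
    · obtain ⟨c, hc, hcH⟩ := exists_norm_eq_one_smul_notMem hv H
      refine ⟨insert (c • v i) H, fun f hf => ?_⟩
      rw [Finset.sum_insert hcH, Finset.sum_insert hi, hf.map_smul c hc, hH f hf]

end Phases

section FunctionalCalculus

variable {A : Type*} [NonUnitalCStarAlgebra A] [PartialOrder A] [StarOrderedRing A]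

theorem exists_add_sub_mul_self_eq {d : A} (hd : 0 ≤ d) (hd1 : ‖d‖ ≤ 1) :
    ∃ e : A, IsSelfAdjoint e ∧ e + e - e * e = d := by
  have hsa : IsSelfAdjoint d := .of_nonneg hd
  set f : ℝ → ℝ := fun t => 1 - √(1 - t) with hf
  have hfc : Continuous f := by fun_prop
  have hf0 : f 0 = 0 := by simp [hf]
  refine ⟨cfcₙ f d, cfcₙ_predicate f d, ?_⟩
  rw [← cfcₙ_add f f d hfc.continuousOn hf0 hfc.continuousOn hf0, ← cfcₙ_mul f f d,
    ← cfcₙ_sub _ _ d]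
  conv_rhs => rw [← cfcₙ_id' ℝ d]
  refine cfcₙ_congr fun t ht => ?_
  have ht1 : t ≤ 1 := (le_abs_self t).trans <|
    (NonUnitalIsometricContinuousFunctionalCalculus.norm_quasispectrum_le d ht).trans hd1
  have hsqrt : √(1 - t) * √(1 - t) = 1 - t := Real.mul_self_sqrt (sub_nonneg.2 ht1)
  simp only [hf]
  linear_combination -hsqrt

/-- A continuous approximation of `t⁻¹` that vanishes at `0`. -/
noncomputable def regularizedInverse (ε t : ℝ) : ℝ := t / (t ^ 2 + ε ^ 2)

theorem continuous_regularizedInverse {ε : ℝ} (hε : 0 < ε) : Continuous (regularizedInverse ε) :=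
  Continuous.div (by fun_prop) (by fun_prop) fun t => by positivity

theorem regularizedInverse_add_sub {ε : ℝ} (hε : 0 < ε) (t : ℝ) :
    regularizedInverse ε t + regularizedInverse ε t -
        regularizedInverse ε t * t * regularizedInverse ε t =
      t * (t ^ 2 + 2 * ε ^ 2) / (t ^ 2 + ε ^ 2) ^ 2 := by
  have : t ^ 2 + ε ^ 2 ≠ 0 := by positivity
  rw [regularizedInverse]
  field_simp
  ring

theorem norm_sub_mul_mul_le {ε : ℝ} (hε : 0 < ε) {t : ℝ} (ht : 0 ≤ t) :
    ‖t - t * (t * (t ^ 2 + 2 * ε ^ 2) / (t ^ 2 + ε ^ 2) ^ 2) * t‖ ≤ ε := by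
  have hresidue : t - t * (t * (t ^ 2 + 2 * ε ^ 2) / (t ^ 2 + ε ^ 2) ^ 2) * t =
      t * ε ^ 4 / (t ^ 2 + ε ^ 2) ^ 2 := by
    have : t ^ 2 + ε ^ 2 ≠ 0 := by positivity
    field_simp
    ring
  have htε : t * ε ≤ t ^ 2 + ε ^ 2 := by nlinarith [sq_nonneg (t - ε), sq_nonneg t, sq_nonneg ε]
  have hε2 : ε ^ 2 ≤ t ^ 2 + ε ^ 2 := by nlinarith [sq_nonneg t]
  rw [hresidue, Real.norm_of_nonneg (by positivity), div_le_iff₀ (by positivity)]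
  calc t * ε ^ 4 = ε * ((t * ε) * ε ^ 2) := by ring
    _ ≤ ε * ((t ^ 2 + ε ^ 2) * (t ^ 2 + ε ^ 2)) := by gcongr
    _ = ε * (t ^ 2 + ε ^ 2) ^ 2 := by ring

theorem exists_approx_inverse {Γ : A} (hΓ : 0 ≤ Γ) {ε : ℝ} (hε : 0 < ε) :
    ∃ h g : A, IsSelfAdjoint h ∧ IsSelfAdjoint g ∧ g * g = h + h - h * Γ * h ∧
      ‖Γ - Γ * (h + h - h * Γ * h) * Γ‖ ≤ ε := by
  have hsa : IsSelfAdjoint Γ := .of_nonneg hΓ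
  have hspec : ∀ t ∈ quasispectrum ℝ Γ, 0 ≤ t := fun t ht =>
    quasispectrum_nonneg_of_nonneg Γ hΓ t ht
  obtain ⟨f, hf⟩ : ∃ f, f = regularizedInverse ε := ⟨_, rfl⟩
  obtain ⟨k, hk⟩ : ∃ k : ℝ → ℝ, k = fun t => f t + f t - f t * t * f t := ⟨_, rfl⟩
  have hk_apply : ∀ t, k t = t * (t ^ 2 + 2 * ε ^ 2) / (t ^ 2 + ε ^ 2) ^ 2 := fun t => by
    rw [hk, hf, ← regularizedInverse_add_sub hε]
  have hfc : Continuous f := hf ▸ continuous_regularizedInverse hε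
  have hkc : Continuous k := by
    rw [hk]
    fun_prop
  have hf0 : f 0 = 0 := by simp [hf, regularizedInverse]
  have hk0 : k 0 = 0 := by simp [hk_apply]
  have hcfck : cfcₙ k Γ = cfcₙ f Γ + cfcₙ f Γ - cfcₙ f Γ * Γ * cfcₙ f Γ := by
    rw [hk, cfcₙ_sub _ _ Γ, cfcₙ_add f f Γ, cfcₙ_mul _ f Γ, cfcₙ_mul f _ Γ, cfcₙ_id' ℝ Γ]
  refine ⟨cfcₙ f Γ, cfcₙ (fun t => √(k t)) Γ, cfcₙ_predicate f Γ, cfcₙ_predicate _ Γ, ?_, ?_⟩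
  · rw [← hcfck, ← cfcₙ_mul _ _ Γ]
    refine cfcₙ_congr fun t ht => Real.mul_self_sqrt ?_
    have := hspec t ht
    rw [hk_apply]
    positivity
  · have hcfc : Γ - Γ * cfcₙ k Γ * Γ = cfcₙ (fun t => t - t * k t * t) Γ := by
      rw [cfcₙ_sub _ _ Γ, cfcₙ_mul _ _ Γ, cfcₙ_mul _ k Γ, cfcₙ_id' ℝ Γ]
    rw [← hcfck, hcfc]
    refine norm_cfcₙ_le fun t ht => ?_
    rw [hk_apply]
    exact norm_sub_mul_mul_le hε (hspec t ht)

end FunctionalCalculus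

section HilbertModules

variable {A : Type*} [NonUnitalCStarAlgebra A] [PartialOrder A]
  {E : Type*} [NormedAddCommGroup E] [NormedSpace ℂ E] [CompleteSpace E]

namespace RightHilbertModule

variable [RightHilbertModule A E]

variable (A) in
/-- The inner product as a linear map in its second variable. -/
def ipRight (x : E) : E →ₗ[ℂ] A where
  toFun y := ip x y
  map_add' := ip_add_right x
  map_smul' c y := ip_smul_right c x y

theorem ip_sub_right (x y z : E) : (ip x (y - z) : A) = ip x y - ip x z :=
  map_sub (ipRight A x) y z

theorem ip_zero_right (x : E) : (ip x 0 : A) = 0 := map_zero (ipRight A x)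

theorem ip_sum_right {ι : Type*} (s : Finset ι) (x : E) (f : ι → E) :
    (ip x (∑ i ∈ s, f i) : A) = ∑ i ∈ s, ip x (f i) := map_sum (ipRight A x) f s

theorem ip_add_left (x y z : E) : (ip (x + y) z : A) = ip x z + ip y z := by
  rw [← star_ip, ip_add_right, star_add, star_ip, star_ip]

theorem ip_sub_left (x y z : E) : (ip (x - y) z : A) = ip x z - ip y z := by
  rw [← star_ip, ip_sub_right, star_sub, star_ip, star_ip]

theorem ip_zero_left (x : E) : (ip 0 x : A) = 0 := by
  rw [← star_ip, ip_zero_right, star_zero]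

theorem ip_smul_left (c : ℂ) (x y : E) : (ip (c • x) y : A) = star c • ip x y := by
  rw [← star_ip, ip_smul_right, star_smul, star_ip]

theorem ip_sum_left {ι : Type*} (s : Finset ι) (f : ι → E) (x : E) :
    (ip (∑ i ∈ s, f i) x : A) = ∑ i ∈ s, ip (f i) x := by
  rw [← star_ip, ip_sum_right, star_sum]
  simp only [star_ip]

theorem ip_ract_left (x y : E) (a : A) : (ip (ract x a) y : A) = star a * ip x y := by
  rw [← star_ip, ip_ract_right, star_mul, star_ip]

theorem phaseInvariant_ip_mul_ip (x y : E) : PhaseInvariant fun ξ : E => (ip x ξ * ip ξ y : A) where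
  map_zero := by rw [ip_zero_right, zero_mul]
  map_smul c hc ξ := by
    have hcc : c * star c = 1 := by simp [Complex.mul_conj', hc]
    rw [ip_smul_left, ip_smul_right, smul_mul_smul_comm, hcc, one_smul]

theorem phaseInvariant_ip_apply (T : E →ₗ[ℂ] E) : PhaseInvariant fun ξ : E => (ip ξ (T ξ) : A) where
  map_zero := ip_zero_left _
  map_smul c hc ξ := by
    have hcc : star c * c = 1 := by simp [Complex.conj_mul', hc]
    rw [map_smul, ip_smul_left, ip_smul_right, smul_smul, hcc, one_smul]

variable [StarOrderedRing A]

theorem ip_mul_ip_nonneg (x y : E) : (0 : A) ≤ ip x y * ip y x := by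
  rw [← star_ip y x]
  exact star_mul_self_nonneg _

/-- This expands `0 ≤ ⟨z, z⟩` for `z = y - x ⟨x, y⟩`. -/
theorem ip_mul_ip_le {x : E} (hx : ‖x‖ ≤ 1) (y : E) : (ip y x * ip x y : A) ≤ ip y y := by
  have hexpand : (ip (y - ract x (ip x y : A)) (y - ract x (ip x y : A)) : A) =
      ip y y - ip y x * ip x y - (ip y x * ip x y - ip y x * ip x x * ip x y) := by
    simp only [ip_sub_left, ip_sub_right, ip_ract_left, ip_ract_right, star_ip, mul_assoc, sub_mul]
  have hcontract : (ip y x * ip x x * ip x y : A) ≤ ip y x * ip x y := by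
    have hnorm : ‖(ip x x : A)‖ ≤ 1 := by
      rw [← norm_sq_eq]
      exact pow_le_one₀ (norm_nonneg _) hx
    have hconj := CStarAlgebra.star_left_conjugate_le_norm_smul (a := (ip x y : A))
      (.of_nonneg (ip_self_nonneg x))
    rw [star_ip] at hconj
    exact hconj.trans <|
      (smul_le_smul_of_nonneg_right hnorm (ip_mul_ip_nonneg y x)).trans_eq (one_smul ℝ _)
  have hnonneg : (0 : A) ≤ ip y y - ip y x * ip x y :=
    (hexpand ▸ ip_self_nonneg _ : (0 : A) ≤ _).trans (sub_le_self _ (sub_nonneg.2 hcontract))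
  exact sub_nonneg.1 hnonneg

theorem norm_ip_le (x y : E) : ‖(ip x y : A)‖ ≤ ‖x‖ * ‖y‖ := by
  rcases eq_or_ne x 0 with rfl | hx
  · simp [ip_zero_left]
  have hunit : ∀ u : E, ‖u‖ ≤ 1 → ‖(ip u y : A)‖ ≤ ‖y‖ := fun u hu => by
    have hsq := CStarAlgebra.norm_le_norm_of_nonneg_of_le (ip_mul_ip_nonneg y u)
      (ip_mul_ip_le (A := A) hu y)
    rw [← star_ip u y, CStarRing.norm_star_mul_self, ← norm_sq_eq, ← sq] at hsq
    exact le_of_sq_le_sq hsq (norm_nonneg y)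
  have hx' : ‖x‖ ≠ 0 := norm_ne_zero_iff.2 hx
  have hscaled := hunit (((‖x‖⁻¹ : ℝ) : ℂ) • x) (by simp [norm_smul, hx'])
  rw [ip_smul_left, norm_smul, norm_star, Complex.norm_real, norm_inv, norm_norm] at hscaled
  rwa [inv_mul_le_iff₀ (by positivity)] at hscaled

theorem continuous_ip : Continuous fun z : E × E => (ip z.1 z.2 : A) :=
  let B : E →ₗ[ℝ] E →ₗ[ℝ] A := LinearMap.mk₂ ℝ ip ip_add_left
    (fun c x y => by simpa using ip_smul_left (A := A) (c : ℂ) x y) ip_add_right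
    (fun c x y => by simpa using ip_smul_right (A := A) (c : ℂ) x y)
  (B.mkContinuous₂ 1 fun x y => (norm_ip_le x y).trans_eq (by rw [one_mul])).continuous₂

end RightHilbertModule

namespace CStarCorrespondence

variable [CStarCorrespondence A E]

theorem ip_lact_star_mul_self (c : A) (x : E) :
    (ip x (lact (star c * c) x) : A) = ip (lact c x) (lact c x) := by
  rw [ip_lact_left, lact_mul]

variable [StarOrderedRing A]

theorem ip_lact_nonneg {a : A} (ha : 0 ≤ a) (x : E) : (0 : A) ≤ ip x (lact a x) := by
  obtain ⟨b, rfl⟩ := CStarAlgebra.nonneg_iff_eq_star_mul_self.1 ha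
  rw [ip_lact_star_mul_self]
  exact ip_self_nonneg _

/-- Writing `d = 2 e - e²`, the difference of the two sides is `⟨(1 - e) x, (1 - e) x⟩`. -/
theorem ip_lact_le {d : A} (hd : 0 ≤ d) (hd1 : ‖d‖ ≤ 1) (x : E) :
    (ip x (lact d x) : A) ≤ ip x x := by
  obtain ⟨e, he, rfl⟩ := exists_add_sub_mul_self_eq hd hd1
  have hsq : (ip (x - lact e x) (x - lact e x) : A) = ip x x - ip x (lact (e + e - e * e) x) := by
    simp only [ip_sub_left, ip_sub_right, ip_lact_left, he.star_eq, map_sub, map_add,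
      LinearMap.sub_apply, LinearMap.add_apply, ip_add_right, lact_mul]
    abel
  exact sub_nonneg.1 (hsq ▸ ip_self_nonneg _)

theorem norm_lact_le (a : A) (x : E) : ‖lact a x‖ ≤ ‖a‖ * ‖x‖ := by
  rcases eq_or_ne a 0 with rfl | ha
  · simp
  have hcontraction : ∀ c : A, ‖c‖ ≤ 1 → ‖lact c x‖ ≤ ‖x‖ := fun c hc => by
    have hcc : ‖star c * c‖ ≤ 1 := by
      rw [CStarRing.norm_star_mul_self]
      exact mul_le_one₀ hc (norm_nonneg _) hc
    have hsq := CStarAlgebra.norm_le_norm_of_nonneg_of_le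
      (ip_lact_nonneg (star_mul_self_nonneg c) x)
      (ip_lact_le (star_mul_self_nonneg c) hcc x)
    rw [ip_lact_star_mul_self, ← norm_sq_eq, ← norm_sq_eq] at hsq
    exact le_of_sq_le_sq hsq (norm_nonneg x)
  have ha' : ‖a‖ ≠ 0 := norm_ne_zero_iff.2 ha
  have hscaled := hcontraction (((‖a‖⁻¹ : ℝ) : ℂ) • a) (by simp [norm_smul, ha'])
  rw [map_smul, LinearMap.smul_apply, norm_smul, Complex.norm_real, norm_inv, norm_norm] at hscaled
  rwa [inv_mul_le_iff₀ (by positivity)] at hscaled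

end CStarCorrespondence

end HilbertModules

section Frames

variable {A : Type*} [NonUnitalCStarAlgebra A] [PartialOrder A]
  {E : Type*} [NormedAddCommGroup E] [NormedSpace ℂ E] [CompleteSpace E]
  [RightHilbertModule A E] {ι κ : Type*}

namespace RightHilbertModule

/-- The form `⟨x, (1 - ∑_{i ∈ s} θ_{v i, v i}) y⟩` of a finite family of vectors, which measures how
far the family is from being a Parseval frame. -/
def defect (s : Finset ι) (v : ι → E) (x y : E) : A := ip x y - ∑ i ∈ s, ip x (v i) * ip (v i) y

variable (A) in
/-- The finite family satisfies `∑_{i ∈ s} θ_{v i, v i} ≤ 1`. Families, unlike sets, may repeat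
vectors, which products of frames do. -/
def IsSubframe (s : Finset ι) (v : ι → E) : Prop := ∀ x : E, (0 : A) ≤ defect s v x x

variable (A) in
/-- The operator `1 - ∑_{i ∈ s} θ_{v i, v i}` has the form `S* S`. -/
def IsSplitSubframe (s : Finset ι) (v : ι → E) : Prop :=
  ∃ S : E →ₗ[ℂ] E, ∀ x y, (defect s v x y : A) = ip (S x) (S y)

variable (A) in
/-- The operators `∑_{i ∈ s k} θ_{v i, v i}` are contractions converging weakly to the identity. -/
structure IsApproxFrame (l : Filter κ) (s : κ → Finset ι) (v : ι → E) : Prop where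
  isSubframe : ∀ k, IsSubframe A (s k) v
  tendsto_defect : ∀ y : E, Tendsto (fun k => (defect (s k) v y y : A)) l (𝓝 0)

theorem sum_add_defect (s : Finset ι) (v : ι → E) (x y : E) :
    ∑ i ∈ s, ip x (v i) * ip (v i) y + (defect s v x y : A) = ip x y :=
  add_sub_cancel _ _

theorem exists_defect_id_eq (s : Finset ι) (v : ι → E) :
    ∃ H : Finset E, ∀ x y, (defect H id x y : A) = defect s v x y := by
  obtain ⟨H, hH⟩ := exists_finset_sum_eq A s v
  exact ⟨H, fun x y => congrArg (ip x y - ·) (hH _ (phaseInvariant_ip_mul_ip x y))⟩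

theorem defect_sum_sum (s : Finset ι) (v : ι → E) {α β : Type*} (t : Finset α) (u : Finset β)
    (x : α → E) (y : β → E) :
    (defect s v (∑ a ∈ t, x a) (∑ b ∈ u, y b) : A) =
      ∑ a ∈ t, ∑ b ∈ u, defect s v (x a) (y b) := by
  simp only [defect, ip_sum_left, ip_sum_right, Finset.sum_mul_sum, Finset.sum_sub_distrib]
  rw [Finset.sum_comm]
  simp only [Finset.sum_comm (s := s)]

theorem defect_smul_smul (s : Finset ι) (v : ι → E) (c d : ℂ) (x y : E) :
    (defect s v (c • x) (d • y) : A) = (star c * d) • defect s v x y := by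
  simp only [defect, ip_smul_left, ip_smul_right, smul_mul_smul_comm, smul_smul, smul_sub,
    Finset.smul_sum, mul_comm d]

theorem defect_add_add_defect_sub (s : Finset ι) (v : ι → E) (x y : E) :
    (defect s v (x + y) (x + y) + defect s v (x - y) (x - y) : A) =
      2 • (defect s v x x + defect s v y y) := by
  simp only [defect, ip_add_left, ip_add_right, ip_sub_left, ip_sub_right, add_mul, mul_add,
    sub_mul, mul_sub, Finset.sum_add_distrib, Finset.sum_sub_distrib]
  abel

theorem IsSplitSubframe.isSubframe {s : Finset ι} {v : ι → E} (h : IsSplitSubframe A s v) :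
    IsSubframe A s v := by
  obtain ⟨S, hS⟩ := h
  exact fun x => hS x x ▸ ip_self_nonneg _

variable [StarOrderedRing A]

theorem isSubframe_id_iff {H : Finset E} :
    IsSubframe A H id ↔ OpLE A (fun η => ∑ ξ ∈ H, theta A ξ ξ η) (fun η => η) := by
  simp only [IsSubframe, OpLE, defect, theta, ip_sum_right, ip_ract_right, sub_nonneg, id_eq]

theorem continuous_defect_self (s : Finset ι) (v : ι → E) :
    Continuous fun x : E => (defect s v x x : A) := by
  have hip : ∀ f g : E → E, Continuous f → Continuous g →
      Continuous fun x => (ip (f x) (g x) : A) :=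
    fun f g hf hg => continuous_ip.comp (hf.prodMk hg)
  exact (hip _ _ continuous_id continuous_id).sub <| continuous_finsetSum _ fun i _ =>
    (hip _ _ continuous_id continuous_const).mul (hip _ _ continuous_const continuous_id)

theorem isSubframe_of_dense {s : Finset ι} {v : ι → E} {D : Set E} (hD : Dense D)
    (h : ∀ x ∈ D, (0 : A) ≤ defect s v x x) : IsSubframe A s v := fun x =>
  closure_minimal h (isClosed_le continuous_const (continuous_defect_self s v)) (hD x)

namespace IsSubframe

variable {s : Finset ι} {v : ι → E}

theorem sum_ip_mul_ip_le (h : IsSubframe A s v) (x : E) :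
    ∑ i ∈ s, ip x (v i) * ip (v i) x ≤ (ip x x : A) := sub_nonneg.1 (h x)

theorem norm_defect_self_le (h : IsSubframe A s v) (x : E) : ‖(defect s v x x : A)‖ ≤ ‖x‖ ^ 2 := by
  rw [norm_sq_eq (A := A)]
  exact CStarAlgebra.norm_le_norm_of_nonneg_of_le (h x) <|
    sub_le_self _ (Finset.sum_nonneg fun i _ => ip_mul_ip_nonneg x (v i))

theorem norm_defect_add_le (h : IsSubframe A s v) (x y : E) :
    ‖(defect s v (x + y) (x + y) : A)‖ ≤
      2 * (‖(defect s v x x : A)‖ + ‖(defect s v y y : A)‖) := by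
  have hle : (defect s v (x + y) (x + y) : A) ≤ 2 • (defect s v x x + defect s v y y) :=
    defect_add_add_defect_sub (A := A) s v x y ▸ le_add_of_nonneg_right (h _)
  refine (CStarAlgebra.norm_le_norm_of_nonneg_of_le (h _) hle).trans ?_
  refine (norm_nsmul_le (n := 2)).trans ?_
  push_cast
  gcongr
  exact norm_add_le _ _

end IsSubframe

/-- One vector `ζ` in the range of `1 - ∑_{ξ ∈ H} θ_{ξ,ξ} = S* S` suffices: with `h` an approximate
inverse of `⟨S η, S η⟩`, the new operator is `T* T` for `T x = S x - (S η) h ⟨S η, S x⟩`. -/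
theorem IsSplitSubframe.exists_norm_defect_le {H : Finset E} (hH : IsSplitSubframe A H id) (η : E)
    {ε : ℝ} (hε : 0 < ε) :
    ∃ H' : Finset E, IsSplitSubframe A H' id ∧ ‖(defect H' id η η : A)‖ ≤ ε ∧
      ∀ x, (defect H' id x x : A) ≤ defect H id x x := by
  obtain ⟨S, hS⟩ := hH
  obtain ⟨h, g, hh, hg, hgg, hnorm⟩ :=
    exists_approx_inverse (ip_self_nonneg (A := A) (S η)) hε
  set ζ : E := ract (η - ∑ ξ ∈ H, ract ξ (ip ξ η : A)) g with hζ
  have hxζ : ∀ x, (ip x ζ : A) = ip (S x) (S η) * g := fun x => by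
    rw [← hS, hζ, ip_ract_right, ip_sub_right, ip_sum_right, defect]
    simp only [ip_ract_right, id_eq]
  have hζζ : ∀ x y, (ip x ζ * ip ζ y : A) =
      ip (S x) (S η) * (h + h - h * ip (S η) (S η) * h) * ip (S η) (S y) := fun x y => by
    rw [← star_ip y ζ, hxζ, hxζ, star_mul, hg.star_eq, star_ip, ← hgg]
    simp only [mul_assoc]
  obtain ⟨H', hH'⟩ := exists_defect_id_eq (A := A) H.insertNone (Option.elim · ζ id)
  have hdefect : ∀ x y, (defect H' id x y : A) = defect H id x y - ip x ζ * ip ζ y := fun x y => by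
    rw [hH', defect, Finset.sum_insertNone, sub_add_eq_sub_sub_swap]
    rfl
  refine ⟨H', ⟨S - ract (S η) ∘ₗ LinearMap.mulLeft ℂ h ∘ₗ ipRight A (S η) ∘ₗ S, fun x y => ?_⟩,
    ?_, fun x => ?_⟩
  · have happly : ∀ z, (S - ract (S η) ∘ₗ LinearMap.mulLeft ℂ h ∘ₗ ipRight A (S η) ∘ₗ S) z =
        S z - ract (S η) (h * (ip (S η) (S z) : A)) := fun z => rfl
    rw [hdefect, hζζ, hS, happly, happly]
    simp only [ip_sub_left, ip_sub_right, ip_ract_left, ip_ract_right, star_mul, star_ip,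
      hh.star_eq, mul_add, add_mul, mul_sub, sub_mul, mul_assoc]
    abel
  · rw [hdefect, hζζ, hS]
    exact hnorm
  · rw [hdefect]
    exact sub_le_self _ (ip_mul_ip_nonneg x ζ)

variable (A) in
theorem exists_isSplitSubframe (F : Finset E) {ε : ℝ} (hε : 0 < ε) :
    ∃ H : Finset E, IsSplitSubframe A H id ∧ ∀ η ∈ F, ‖(defect H id η η : A)‖ ≤ ε := by
  classical
  induction F using Finset.induction_on with
  | empty => exact ⟨∅, ⟨LinearMap.id, fun x y => by simp [defect]⟩, by simp⟩
  | insert η F _ ih =>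
    obtain ⟨H, hH, hF⟩ := ih
    obtain ⟨H', hH', hη, hle⟩ := hH.exists_norm_defect_le η hε
    refine ⟨H', hH', Finset.forall_mem_insert _ _ _ |>.2 ⟨hη, fun x hx => ?_⟩⟩
    exact (CStarAlgebra.norm_le_norm_of_nonneg_of_le (hH'.isSubframe x) (hle x)).trans (hF x hx)

variable (A) in
/-- An approximate frame of a Hilbert module, indexed by the finite set of vectors to be
approximated and the precision. -/
noncomputable def approxFrame (k : Finset E × ℕ) : Finset E :=
  (exists_isSplitSubframe A k.1 (Nat.one_div_pos_of_nat (α := ℝ) (n := k.2))).choose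

theorem isSplitSubframe_approxFrame (k : Finset E × ℕ) :
    IsSplitSubframe A (approxFrame A k) id :=
  (exists_isSplitSubframe A k.1 (Nat.one_div_pos_of_nat (n := k.2))).choose_spec.1

theorem norm_defect_approxFrame_le {k : Finset E × ℕ} {η : E} (hη : η ∈ k.1) :
    ‖(defect (approxFrame A k) id η η : A)‖ ≤ 1 / (k.2 + 1) :=
  (exists_isSplitSubframe A k.1 (Nat.one_div_pos_of_nat (n := k.2))).choose_spec.2 η hη

theorem isApproxFrame_approxFrame : IsApproxFrame A atTop (approxFrame A (E := E)) id where
  isSubframe k := (isSplitSubframe_approxFrame k).isSubframe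
  tendsto_defect y := by
    have hmem : ∀ᶠ k : Finset E × ℕ in atTop, y ∈ k.1 := by
      filter_upwards [eventually_ge_atTop ({y}, 0)] with k hk
      exact hk.1 (Finset.mem_singleton_self y)
    have hprec : Tendsto (fun k : Finset E × ℕ => 1 / ((k.2 : ℝ) + 1)) atTop (𝓝 0) := by
      rw [← prod_atTop_atTop_eq]
      exact tendsto_one_div_add_atTop_nhds_zero_nat.comp tendsto_snd
    exact squeeze_zero_norm' (hmem.mono fun k => norm_defect_approxFrame_le) hprec

theorem IsApproxFrame.of_dense_span {l : Filter κ} {s : κ → Finset ι} {v : ι → E} {D : Set E}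
    (hsub : ∀ k, IsSubframe A (s k) v) (hD : Dense (Submodule.span ℂ D : Set E))
    (h : ∀ y ∈ D, Tendsto (fun k => (defect (s k) v y y : A)) l (𝓝 0)) :
    IsApproxFrame A l s v where
  isSubframe := hsub
  tendsto_defect y := by
    have hspan : ∀ y ∈ Submodule.span ℂ D,
        Tendsto (fun k => ‖(defect (s k) v y y : A)‖) l (𝓝 0) := fun y hy => by
      induction hy using Submodule.span_induction with
      | mem y hy => exact tendsto_zero_iff_norm_tendsto_zero.1 (h y hy)
      | zero => simp [defect, ip_zero_left, tendsto_const_nhds]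
      | add x y _ _ hx hy =>
        exact squeeze_zero (fun _ => norm_nonneg _) (fun k => (hsub k).norm_defect_add_le x y)
          (by simpa using (hx.add hy).const_mul 2)
      | smul c y _ hy =>
        simp only [defect_smul_smul, norm_smul]
        simpa using hy.const_mul ‖star c * c‖
    rw [tendsto_zero_iff_norm_tendsto_zero, Metric.tendsto_nhds]
    intro ε hε
    obtain ⟨z, hz, hyz⟩ := Metric.dense_iff.1 hD y (√(ε / 4)) (by positivity)
    rw [Metric.mem_ball', dist_eq_norm] at hz
    filter_upwards [(hspan z hyz).eventually_lt_const (by positivity : 0 < ε / 4)] with k hk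
    have hsq : ‖y - z‖ ^ 2 < ε / 4 := Real.lt_sqrt (norm_nonneg _) |>.1 hz
    have hle := (hsub k).norm_defect_add_le z (y - z)
    have hrest := (hsub k).norm_defect_self_le (y - z)
    rw [add_sub_cancel] at hle
    rw [dist_zero_right, norm_norm]
    linarith

end RightHilbertModule

end Frames

section Weights

variable {A : Type*} [NonUnitalCStarAlgebra A] [PartialOrder A]

/-- The restriction of `σ` to the positive cone of `A` is a bounded trace. The values of `σ` off
the cone are irrelevant. -/
structure IsBoundedTrace (σ : A → ℝ≥0∞) : Prop where
  add : ∀ a b, 0 ≤ a → 0 ≤ b → σ (a + b) = σ a + σ b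
  trace : ∀ c, σ (star c * c) = σ (c * star c)
  bound : ∃ C : ℝ≥0, ∀ a, 0 ≤ a → σ a ≤ C * ‖a‖ₑ

/-- The weight `a ↦ τ(a)` of a positive functional `τ`, with values in `[0, ∞]`; off the positive
cone it is junk. -/
noncomputable def traceWeight (τ : A →L[ℂ] ℂ) (a : A) : ℝ≥0∞ := ENNReal.ofReal (τ a).re

theorem isBoundedTrace_traceWeight {τ : A →L[ℂ] ℂ} (hpos : ∀ a, 0 ≤ a → 0 ≤ τ a)
    (htr : ∀ a b, τ (a * b) = τ (b * a)) : IsBoundedTrace (traceWeight τ) where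
  add a b ha hb := by
    rw [traceWeight, map_add, Complex.add_re]
    exact ENNReal.ofReal_add (Complex.le_def.1 (hpos a ha)).1 (Complex.le_def.1 (hpos b hb)).1
  trace c := by rw [traceWeight, htr, traceWeight]
  bound := ⟨‖τ‖₊, fun a _ => calc
    traceWeight τ a ≤ ‖τ a‖ₑ := by
      rw [← ofReal_norm]
      exact ENNReal.ofReal_le_ofReal (Complex.re_le_norm _)
    _ ≤ ‖τ‖₊ * ‖a‖ₑ := τ.le_opENorm a⟩

namespace IsBoundedTrace

variable {σ : A → ℝ≥0∞}

theorem ne_top (hσ : IsBoundedTrace σ) {a : A} (ha : 0 ≤ a) : σ a ≠ ⊤ := by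
  obtain ⟨C, hC⟩ := hσ.bound
  exact ne_top_of_le_ne_top (ENNReal.mul_ne_top ENNReal.coe_ne_top enorm_ne_top) (hC a ha)

theorem zero (hσ : IsBoundedTrace σ) : σ 0 = 0 := by
  obtain ⟨C, hC⟩ := hσ.bound
  simpa using hC 0 le_rfl

theorem tendsto_zero (hσ : IsBoundedTrace σ) {κ : Type*} {l : Filter κ} {f : κ → A}
    (hf : ∀ k, 0 ≤ f k) (h : Tendsto f l (𝓝 0)) : Tendsto (fun k => σ (f k)) l (𝓝 0) := by
  obtain ⟨C, hC⟩ := hσ.bound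
  have hlim : Tendsto (fun k => C * ‖f k‖ₑ) l (𝓝 0) := by
    simpa using ENNReal.Tendsto.const_mul h.enorm (Or.inr (ENNReal.coe_ne_top (r := C)))
  exact tendsto_of_tendsto_of_tendsto_of_le_of_le tendsto_const_nhds hlim
    (fun _ => zero_le) fun k => hC _ (hf k)

variable [StarOrderedRing A]

theorem sum (hσ : IsBoundedTrace σ) {ι : Type*} (s : Finset ι) (f : ι → A)
    (hf : ∀ i ∈ s, 0 ≤ f i) : σ (∑ i ∈ s, f i) = ∑ i ∈ s, σ (f i) := by
  classical
  induction s using Finset.induction_on with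
  | empty => simpa using hσ.zero
  | insert i s hi ih =>
    obtain ⟨hfi, hfs⟩ := Finset.forall_mem_insert _ _ _ |>.1 hf
    rw [Finset.sum_insert hi, Finset.sum_insert hi, hσ.add _ _ hfi (Finset.sum_nonneg hfs), ih hfs]

theorem mono (hσ : IsBoundedTrace σ) {a b : A} (ha : 0 ≤ a) (hab : a ≤ b) : σ a ≤ σ b := calc
  σ a ≤ σ a + σ (b - a) := le_self_add
  _ = σ b := by rw [← hσ.add a (b - a) ha (sub_nonneg.2 hab), add_sub_cancel]

end IsBoundedTrace

variable {E : Type*} [NormedAddCommGroup E] [NormedSpace ℂ E] [CompleteSpace E]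
  [CStarCorrespondence A E]

variable (E) in
/-- The weight `a ↦ sup_H ∑_{ξ ∈ H} σ(⟨ξ, a ξ⟩)` induced on `A` by a weight `σ`. -/
noncomputable def inducedWeight (σ : A → ℝ≥0∞) (a : A) : ℝ≥0∞ :=
  ⨆ (H : Finset E) (_ : IsSubframe A H id), ∑ ξ ∈ H, σ (ip ξ (lact a ξ))

theorem inducedWeight_const_mul (c : ℝ≥0∞) (σ : A → ℝ≥0∞) (a : A) :
    inducedWeight E (fun b => c * σ b) a = c * inducedWeight E σ a := by
  simp only [inducedWeight, ENNReal.mul_iSup, Finset.mul_sum]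

variable [StarOrderedRing A] {σ : A → ℝ≥0∞}

theorem inducedWeight_mono {σ' : A → ℝ≥0∞} (h : ∀ a, 0 ≤ a → σ a ≤ σ' a) {a : A} (ha : 0 ≤ a) :
    inducedWeight E σ a ≤ inducedWeight E σ' a :=
  iSup₂_mono fun _ _ => Finset.sum_le_sum fun ξ _ => h _ (ip_lact_nonneg ha ξ)

theorem inducedTrace_lact_eq {τ : A →L[ℂ] ℂ} (hpos : ∀ a, 0 ≤ a → 0 ≤ τ a) {a : A} (ha : 0 ≤ a) :
    inducedTrace τ (fun ξ : E => lact a ξ) = inducedWeight E (traceWeight τ) a := by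
  rw [inducedTrace, inducedWeight, iSup_subtype]
  refine iSup_congr fun H => iSup_congr_Prop isSubframe_id_iff.symm fun _ => ?_
  exact ENNReal.ofReal_sum_of_nonneg fun ξ _ => (Complex.le_def.1 (hpos _ (ip_lact_nonneg ha ξ))).1

variable {ι ι' κ : Type*} {s : Finset ι} {v : ι → E}

namespace IsBoundedTrace

theorem sum_le_inducedWeight (hσ : IsBoundedTrace σ) (hs : IsSubframe A s v) {a : A} (ha : 0 ≤ a) :
    ∑ i ∈ s, σ (ip (v i) (lact a (v i))) ≤ inducedWeight E σ a := by
  obtain ⟨H, hH⟩ := exists_finset_sum_eq A s v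
  have hframe : IsSubframe A H id := fun x => by
    simpa only [defect, id_eq, hH _ (phaseInvariant_ip_mul_ip x x)] using hs x
  calc ∑ i ∈ s, σ (ip (v i) (lact a (v i)))
      = σ (∑ i ∈ s, ip (v i) (lact a (v i))) := (hσ.sum _ _ fun i _ => ip_lact_nonneg ha _).symm
    _ = σ (∑ ξ ∈ H, ip ξ (lact a ξ)) := by rw [hH _ (phaseInvariant_ip_apply (lact a))]
    _ = ∑ ξ ∈ H, σ (ip ξ (lact a ξ)) := hσ.sum _ _ fun ξ _ => ip_lact_nonneg ha ξ
    _ ≤ inducedWeight E σ a :=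
        le_iSup₂ (f := fun (H : Finset E) (_ : IsSubframe A H id) =>
          ∑ ξ ∈ H, σ (ip ξ (lact a ξ))) H hframe

theorem map_ip_self_eq (hσ : IsBoundedTrace σ) (hs : IsSubframe A s v) (x : E) :
    σ (ip x x) = ∑ i ∈ s, σ (ip (v i) x * ip x (v i)) + σ (defect s v x x) := by
  have htrace : ∀ i, σ (ip x (v i) * ip (v i) x) = σ (ip (v i) x * ip x (v i)) := fun i => by
    simpa only [star_ip] using hσ.trace (ip (v i) x)
  have hnonneg : ∀ i ∈ s, (0 : A) ≤ ip x (v i) * ip (v i) x := fun i _ => ip_mul_ip_nonneg x (v i)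
  rw [← sum_add_defect s v x x, hσ.add _ _ (Finset.sum_nonneg hnonneg) (hs x), hσ.sum _ _ hnonneg]
  simp only [htrace]

theorem sum_map_ip_mul_ip_le (hσ : IsBoundedTrace σ) (hs : IsSubframe A s v) (x : E) :
    ∑ i ∈ s, σ (ip x (v i) * ip (v i) x) ≤ σ (ip x x) := by
  rw [← hσ.sum _ _ fun i _ => ip_mul_ip_nonneg x (v i)]
  exact hσ.mono (Finset.sum_nonneg fun i _ => ip_mul_ip_nonneg x (v i)) (hs.sum_ip_mul_ip_le x)

theorem sum_star_mul_self_le (hσ : IsBoundedTrace σ) (hs : IsSubframe A s v)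
    {t : Finset ι'} {w : ι' → E} (ht : IsSubframe A t w) (c : A) :
    ∑ j ∈ t, σ (ip (w j) (lact (star c * c) (w j))) ≤
      ∑ i ∈ s, σ (ip (v i) (lact (c * star c) (v i))) +
        ∑ j ∈ t, σ (defect s v (lact c (w j)) (lact c (w j))) := by
  have hadj : ∀ i j, (ip (v i) (lact c (w j)) * ip (lact c (w j)) (v i) : A) =
      ip (lact (star c) (v i)) (w j) * ip (w j) (lact (star c) (v i)) := fun i j => by
    rw [ip_lact_left, ip_lact_left, star_star]
  have hcc : ∀ i, (ip (v i) (lact (c * star c) (v i)) : A) =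
      ip (lact (star c) (v i)) (lact (star c) (v i)) := fun i => by
    rw [← ip_lact_star_mul_self, star_star]
  simp only [ip_lact_star_mul_self, hcc, hσ.map_ip_self_eq hs (lact c (w _)), hadj,
    Finset.sum_add_distrib]
  rw [Finset.sum_comm]
  gcongr with i
  exact hσ.sum_map_ip_mul_ip_le ht _

theorem inducedWeight_le_liminf (hσ : IsBoundedTrace σ) {l : Filter κ} {s : κ → Finset ι}
    (hs : IsApproxFrame A l s v) (c : A) :
    inducedWeight E σ (star c * c) ≤
      liminf (fun k => ∑ i ∈ s k, σ (ip (v i) (lact (c * star c) (v i)))) l := by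
  refine iSup₂_le fun H hH => ?_
  have hdefect : Tendsto (fun k => ∑ ξ ∈ H, σ (defect (s k) v (lact c ξ) (lact c ξ))) l (𝓝 0) := by
    rw [← Finset.sum_const_zero (s := H)]
    exact tendsto_finsetSum H fun ξ _ =>
      hσ.tendsto_zero (fun k => hs.isSubframe k _) (hs.tendsto_defect _)
  rw [← ENNReal.liminf_add_of_right_tendsto_zero hdefect]
  exact le_liminf_of_le (h := .of_forall fun k => hσ.sum_star_mul_self_le (hs.isSubframe k) hH c)

theorem tendsto_inducedWeight (hσ : IsBoundedTrace σ) {l : Filter κ} {s : κ → Finset ι}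
    (hs : IsApproxFrame A l s v) {a : A} (ha : 0 ≤ a) :
    Tendsto (fun k => ∑ i ∈ s k, σ (ip (v i) (lact a (v i)))) l (𝓝 (inducedWeight E σ a)) := by
  have hsqrt : star (CFC.sqrt a) = CFC.sqrt a :=
    (IsSelfAdjoint.of_nonneg (CFC.sqrt_nonneg a)).star_eq
  have hliminf := hσ.inducedWeight_le_liminf hs (CFC.sqrt a)
  rw [hsqrt, CFC.sqrt_mul_sqrt_self a ha] at hliminf
  exact tendsto_of_le_liminf_of_limsup_le hliminf <|
    limsup_le_of_le (h := .of_forall fun k => hσ.sum_le_inducedWeight (hs.isSubframe k) ha)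

theorem inducedWeight_star_mul_self_le (hσ : IsBoundedTrace σ) (c : A) :
    inducedWeight E σ (star c * c) ≤ inducedWeight E σ (c * star c) := by
  classical
  have hlim :=
    hσ.tendsto_inducedWeight (isApproxFrame_approxFrame (E := E)) (mul_star_self_nonneg c)
  exact hlim.liminf_eq ▸ hσ.inducedWeight_le_liminf isApproxFrame_approxFrame c

theorem inducedWeight (hσ : IsBoundedTrace σ)
    (hbound : ∃ C : ℝ≥0, ∀ a, 0 ≤ a → inducedWeight E σ a ≤ C * ‖a‖ₑ) :
    IsBoundedTrace (inducedWeight E σ) where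
  add a b ha hb := by
    classical
    have hlim {c : A} (hc : 0 ≤ c) :=
      hσ.tendsto_inducedWeight (isApproxFrame_approxFrame (E := E)) hc
    refine tendsto_nhds_unique (hlim (add_nonneg ha hb))
      (((hlim ha).add (hlim hb)).congr fun k => ?_)
    rw [← Finset.sum_add_distrib]
    refine Finset.sum_congr rfl fun ξ _ => ?_
    rw [map_add, LinearMap.add_apply, ip_add_right,
      hσ.add _ _ (ip_lact_nonneg ha _) (ip_lact_nonneg hb _)]
  trace c := le_antisymm (hσ.inducedWeight_star_mul_self_le c) <| by
    simpa only [star_star] using hσ.inducedWeight_star_mul_self_le (E := E) (star c)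
  bound := hbound

end IsBoundedTrace

end Weights

theorem tendsto_of_tendsto_curry {α β Y : Type*} [TopologicalSpace Y] [RegularSpace Y]
    {l : Filter α} {l' : Filter β} [l'.NeBot] {f : α × β → Y} {g : α → Y} {y : Y}
    (hf : Tendsto f (l.curry l') (𝓝 y)) (hg : ∀ a, Tendsto (fun b => f (a, b)) l' (𝓝 (g a))) :
    Tendsto g l (𝓝 y) := by
  refine (closed_nhds_basis y).tendsto_right_iff.2 fun C hC => ?_
  filter_upwards [eventually_curry_iff.1 (hf.eventually hC.1)] with a ha
  exact hC.2.mem_of_tendsto (hg a) ha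

theorem exists_eq_sum_of_mem_span {R E F Z : Type*} [CommSemiring R] [AddCommMonoid E] [Module R E]
    [AddCommMonoid F] [Module R F] [AddCommMonoid Z] [Module R Z] {m : E →ₗ[R] F →ₗ[R] Z} {y : Z}
    (hy : y ∈ Submodule.span R {y : Z | ∃ ξ ζ, y = m ξ ζ}) :
    ∃ (n : ℕ) (ξ : Fin n → E) (ζ : Fin n → F), y = ∑ j, m (ξ j) (ζ j) := by
  obtain ⟨n, f, g, rfl⟩ := Submodule.mem_span_set'.1 hy
  choose ξ ζ h using fun j => (g j).2
  refine ⟨n, fun j => f j • ξ j, ζ, Finset.sum_congr rfl fun j _ => ?_⟩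
  rw [h j, map_smul, LinearMap.smul_apply]

section InternalTensor

variable {A : Type*} [NonUnitalCStarAlgebra A] [PartialOrder A]
  {E F Z : Type*} [NormedAddCommGroup E] [NormedSpace ℂ E] [CompleteSpace E]
  [NormedAddCommGroup F] [NormedSpace ℂ F] [CompleteSpace F]
  [NormedAddCommGroup Z] [NormedSpace ℂ Z] [CompleteSpace Z]
  [CStarCorrespondence A E] [CStarCorrespondence A F] [CStarCorrespondence A Z]

namespace IsInternalTensor

variable {m : E →ₗ[ℂ] F →ₗ[ℂ] Z} {ι ι' : Type*} {s : Finset ι} {v : ι → E} {t : Finset ι'}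
  {w : ι' → F}

theorem defect_product (hm : IsInternalTensor A m) (s : Finset ι) (v : ι → E) (t : Finset ι')
    (w : ι' → F) (ξ ξ' : E) (ζ ζ' : F) :
    (defect (s ×ˢ t) (fun z => m (v z.1) (w z.2)) (m ξ ζ) (m ξ' ζ') : A) =
      ip ζ (lact (defect s v ξ ξ' : A) ζ') +
        ∑ i ∈ s, defect t w (lact (ip (v i) ξ : A) ζ) (lact (ip (v i) ξ' : A) ζ') := by
  simp only [defect, hm.ip_eq, ip_lact_left, star_ip, map_sub, map_sum, LinearMap.sub_apply,
    LinearMap.sum_apply, ip_sub_right, ip_sum_right, lact_mul, Finset.sum_sub_distrib,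
    Finset.sum_product]
  abel

variable [StarOrderedRing A]

/-- With `1 - ∑ θ_{v i, v i} = S* S`, the defect at `∑ m (ξ j) (ζ j)` is the square of
`∑ m (S (ξ j)) (ζ j)` plus defects of the second family. -/
theorem isSubframe_product (hm : IsInternalTensor A m) (hs : IsSplitSubframe A s v)
    (ht : IsSubframe A t w) : IsSubframe A (s ×ˢ t) fun z => m (v z.1) (w z.2) := by
  obtain ⟨S, hS⟩ := hs
  refine isSubframe_of_dense hm.dense_span fun y hy => ?_
  obtain ⟨n, ξ, ζ, rfl⟩ := exists_eq_sum_of_mem_span hy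
  have hdefect : (defect (s ×ˢ t) (fun z => m (v z.1) (w z.2)) (∑ j, m (ξ j) (ζ j))
      (∑ j, m (ξ j) (ζ j)) : A) =
        ip (∑ j, m (S (ξ j)) (ζ j)) (∑ j, m (S (ξ j)) (ζ j)) +
          ∑ i ∈ s, defect t w (∑ j, lact (ip (v i) (ξ j) : A) (ζ j))
            (∑ j, lact (ip (v i) (ξ j) : A) (ζ j)) := by
    simp only [defect_sum_sum, hm.defect_product, hS, ← hm.ip_eq, ip_sum_left, ip_sum_right,
      Finset.sum_add_distrib, Finset.sum_comm (s := s)]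
    congr 1
    exact Finset.sum_comm
  rw [hdefect]
  exact add_nonneg (ip_self_nonneg _) (Finset.sum_nonneg fun i _ => ht _)

theorem isApproxFrame_product (hm : IsInternalTensor A m) {κ κ' : Type*} {l : Filter κ}
    {l' : Filter κ'} {s : κ → Finset ι} {t : κ' → Finset ι'} (hs : IsApproxFrame A l s v)
    (hsplit : ∀ k, IsSplitSubframe A (s k) v) (ht : IsApproxFrame A l' t w) :
    IsApproxFrame A (l.curry l') (fun k => s k.1 ×ˢ t k.2) fun z => m (v z.1) (w z.2) := by
  refine .of_dense_span (fun k => hm.isSubframe_product (hsplit k.1) (ht.isSubframe k.2))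
    hm.dense_span ?_
  rintro _ ⟨ξ, ζ, rfl⟩
  have hfirst : Tendsto (fun k => (ip ζ (lact (defect (s k) v ξ ξ : A) ζ) : A)) l (𝓝 0) := by
    have hnorm : Tendsto (fun k => ‖ζ‖ * (‖(defect (s k) v ξ ξ : A)‖ * ‖ζ‖)) l (𝓝 0) := by
      simpa using ((hs.tendsto_defect ξ).norm.mul_const ‖ζ‖).const_mul ‖ζ‖
    refine squeeze_zero_norm (fun k => (norm_ip_le _ _).trans ?_) hnorm
    gcongr
    exact norm_lact_le _ _
  have hsecond : ∀ k, Tendsto (fun k' => ∑ i ∈ s k, (defect (t k') w (lact (ip (v i) ξ : A) ζ)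
      (lact (ip (v i) ξ : A) ζ) : A)) l' (𝓝 0) := fun k => by
    simpa using tendsto_finsetSum (s k) fun i _ => ht.tendsto_defect (lact (ip (v i) ξ : A) ζ)
  have hlim := ((hfirst.comp tendsto_fst).mono_left curry_le_prod).add
    (Tendsto.curry (.of_forall hsecond))
  rw [add_zero] at hlim
  exact hlim.congr fun k => (hm.defect_product (s k.1) v (t k.2) w ξ ξ ζ ζ).symm

/-- Induction in stages: sum over products of approximate frames, in the two possible orders of
limits. -/
theorem inducedWeight_eq (hm : IsInternalTensor A m)
    (hl : ∀ (a : A) ξ ζ, lact a (m ξ ζ) = m (lact a ξ) ζ) {σ : A → ℝ≥0∞} (hσ : IsBoundedTrace σ)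
    (hσF : IsBoundedTrace (inducedWeight F σ)) {a : A} (ha : 0 ≤ a) :
    inducedWeight Z σ a = inducedWeight E (inducedWeight F σ) a := by
  classical
  have hE := isApproxFrame_approxFrame (A := A) (E := E)
  have hF := isApproxFrame_approxFrame (A := A) (E := F)
  have hcurry := hσ.tendsto_inducedWeight
    (hm.isApproxFrame_product hE isSplitSubframe_approxFrame hF) ha
  simp only [Finset.sum_product, hl, hm.ip_eq] at hcurry
  have hinner : ∀ k, Tendsto (fun k' => ∑ ξ ∈ approxFrame A (E := E) k,
      ∑ ζ ∈ approxFrame A (E := F) k', σ (ip ζ (lact (ip ξ (lact a ξ) : A) ζ))) atTop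
      (𝓝 (∑ ξ ∈ approxFrame A (E := E) k, inducedWeight F σ (ip ξ (lact a ξ)))) := fun k =>
    tendsto_finsetSum _ fun ξ _ => hσ.tendsto_inducedWeight hF (ip_lact_nonneg ha ξ)
  exact tendsto_nhds_unique (tendsto_of_tendsto_curry hcurry hinner)
    (hσF.tendsto_inducedWeight hE ha)

end IsInternalTensor

theorem inducedWeight_eq_of_linearEquiv [StarOrderedRing A] {σ : A → ℝ≥0∞} (hσ : IsBoundedTrace σ)
    (U : A ≃ₗ[ℂ] E) (hip : ∀ a b : A, ip (U a) (U b) = star a * b)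
    (hl : ∀ a b : A, lact a (U b) = U (a * b)) {a : A} (ha : 0 ≤ a) :
    inducedWeight E σ a = σ a := by
  classical
  have hsqrt : star (CFC.sqrt a) = CFC.sqrt a :=
    (IsSelfAdjoint.of_nonneg (CFC.sqrt_nonneg a)).star_eq
  have hsq : CFC.sqrt a * CFC.sqrt a = a := CFC.sqrt_mul_sqrt_self a ha
  have hterm : ∀ ξ : E, (ip ξ (U (CFC.sqrt a)) * ip (U (CFC.sqrt a)) ξ : A) = ip ξ (lact a ξ) :=
    fun ξ => by
      obtain ⟨z, rfl⟩ := U.surjective ξ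
      rw [hip, hip, hl, hip, hsqrt, mul_assoc, ← mul_assoc (CFC.sqrt a), hsq]
  have hframe := isApproxFrame_approxFrame (A := A) (E := E)
  have hsum : ∀ k, σ a = ∑ ξ ∈ approxFrame A (E := E) k, σ (ip ξ (lact a ξ)) +
      σ (defect (approxFrame A k) id (U (CFC.sqrt a)) (U (CFC.sqrt a))) := fun k => by
    have h := hσ.map_ip_self_eq (hframe.isSubframe k) (U (CFC.sqrt a))
    simpa only [id_eq, hip, hsqrt, hsq, hterm] using h
  have hlim := (hσ.tendsto_inducedWeight hframe ha).add
    (hσ.tendsto_zero (fun k => hframe.isSubframe k _) (hframe.tendsto_defect (U (CFC.sqrt a))))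
  rw [add_zero] at hlim
  exact tendsto_nhds_unique hlim (tendsto_const_nhds.congr hsum)

end InternalTensor

section InclusionExclusion

variable {α V : Type*} [AddCommGroup V]

/-- The alternating sum `∑_{K ⊆ 𝒞} (-1)^|K| φ(S ∩ ⋂ K)`: the value of a set function `φ`, as if it
were additive, on the complement in `S` of the union of the family `𝒞`. -/
def inclusionExclusion (φ : Set α → V) (𝒞 : Finset (Set α)) (S : Set α) : V :=
  ∑ K ∈ 𝒞.powerset, (-1 : ℤ) ^ K.card • φ (S ∩ ⋂₀ (K : Set (Set α)))

open Classical in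
theorem inclusionExclusion_insert (φ : Set α → V) (C : Set α) (𝒞 : Finset (Set α)) (S : Set α) :
    inclusionExclusion φ (insert C 𝒞) S =
      inclusionExclusion φ 𝒞 S - inclusionExclusion φ 𝒞 (S ∩ C) := by
  have hnotMem : ∀ 𝒞 : Finset (Set α), C ∉ 𝒞 → ∀ S, inclusionExclusion φ (insert C 𝒞) S =
      inclusionExclusion φ 𝒞 S - inclusionExclusion φ 𝒞 (S ∩ C) := fun 𝒞 hC S => by
    rw [inclusionExclusion, Finset.sum_powerset_insert hC, sub_eq_add_neg, inclusionExclusion,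
      inclusionExclusion, ← Finset.sum_neg_distrib]
    congr 1
    refine Finset.sum_congr rfl fun K hK => ?_
    rw [Finset.card_insert_of_notMem fun h => hC (Finset.mem_powerset.1 hK h), Finset.coe_insert,
      Set.sInter_insert, Set.inter_assoc, pow_succ, mul_neg_one, neg_smul]
  by_cases hC : C ∈ 𝒞
  · have herase := hnotMem (𝒞.erase C) (Finset.notMem_erase C 𝒞) (S ∩ C)
    rw [Finset.insert_erase hC, Set.inter_assoc, Set.inter_self, sub_self] at herase
    rw [Finset.insert_eq_of_mem hC, herase, sub_zero]
  · exact hnotMem 𝒞 hC S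

open Classical in
theorem inclusionExclusion_insert_of_subset (φ : Set α → V) {C S : Set α} (h : S ⊆ C)
    (𝒞 : Finset (Set α)) : inclusionExclusion φ (insert C 𝒞) S = 0 := by
  rw [inclusionExclusion_insert, Set.inter_eq_self_of_subset_left h, sub_self]

open Classical in
theorem inclusionExclusion_insert_eq_add (φ : Set α → V) {B C : Set α} (h : C ⊆ B)
    (𝒞 : Finset (Set α)) (S : Set α) :
    inclusionExclusion φ (insert C 𝒞) S =
      inclusionExclusion φ (insert B 𝒞) S + inclusionExclusion φ (insert C 𝒞) (S ∩ B) := by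
  simp only [inclusionExclusion_insert, Set.inter_assoc, Set.inter_eq_self_of_subset_right h]
  abel

theorem inclusionExclusion_empty_right {φ : Set α → V} (hφ : φ ∅ = 0) (𝒞 : Finset (Set α)) :
    inclusionExclusion φ 𝒞 ∅ = 0 := by
  simp only [inclusionExclusion, Set.empty_inter, hφ, smul_zero, Finset.sum_const_zero]

open Classical in
theorem inclusionExclusion_insert_empty {φ : Set α → V} (hφ : φ ∅ = 0) (𝒞 : Finset (Set α))
    (S : Set α) : inclusionExclusion φ (insert ∅ 𝒞) S = inclusionExclusion φ 𝒞 S := by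
  rw [inclusionExclusion_insert, Set.inter_empty, inclusionExclusion_empty_right hφ, sub_zero]

open Classical in
theorem inclusionExclusion_erase_empty {φ : Set α → V} (hφ : φ ∅ = 0) (𝒞 : Finset (Set α))
    (S : Set α) : inclusionExclusion φ (𝒞.erase ∅) S = inclusionExclusion φ 𝒞 S := by
  by_cases h : ∅ ∈ 𝒞
  · rw [← inclusionExclusion_insert_empty hφ, Finset.insert_erase h]
  · rw [Finset.erase_eq_of_notMem h]

open Classical in
theorem inclusionExclusion_image (φ : Set α → V) {ι : Type*} {C : ι → Set α}
    (hC : Function.Injective C) (J : Finset ι) (S : Set α) :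
    inclusionExclusion φ (J.image C) S =
      ∑ K ∈ J.powerset, (-1 : ℤ) ^ K.card • φ (S ∩ ⋂ i ∈ K, C i) := by
  rw [inclusionExclusion, Finset.powerset_image,
    Finset.sum_image (Finset.image_injective hC).injOn]
  simp only [Finset.card_image_of_injective _ hC, Finset.coe_image, Set.sInter_image,
    Finset.mem_coe]

open Classical in
theorem inclusionExclusion_image_right (φ : Set α → V) (f : α → α) (𝒞 : Finset (Set α))
    (S : Set α) : inclusionExclusion φ 𝒞 (f '' S) =
      inclusionExclusion (fun T => φ (f '' T)) (𝒞.image (f ⁻¹' ·)) S := by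
  induction 𝒞 using Finset.induction_on generalizing S with
  | empty => simp [inclusionExclusion]
  | insert C 𝒞 _ ih =>
    rw [Finset.image_insert, inclusionExclusion_insert, inclusionExclusion_insert, ← ih, ← ih,
      Set.image_inter_preimage]

/-- Integral combinations of values of `φ` that are nonnegative stay so when all sets are moved by
`f`. -/
def IsShiftPositive [PartialOrder V] (φ : Set α → V) (f : α → α) : Prop :=
  ∀ c : Set α →₀ ℤ, 0 ≤ Finsupp.linearCombination ℤ φ c →
    0 ≤ Finsupp.linearCombination ℤ (fun S => φ (f '' S)) c

open Classical in
theorem IsShiftPositive.inclusionExclusion_image_nonneg [PartialOrder V] {φ : Set α → V} {f : α → α}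
    (hf : IsShiftPositive φ f) {𝒞 : Finset (Set α)} {S : Set α}
    (h : 0 ≤ inclusionExclusion φ (𝒞.image (f ⁻¹' ·)) S) :
    0 ≤ inclusionExclusion φ 𝒞 (f '' S) := by
  have heq : ∀ ψ : Set α → V, inclusionExclusion ψ (𝒞.image (f ⁻¹' ·)) S =
      Finsupp.linearCombination ℤ ψ (∑ K ∈ (𝒞.image (f ⁻¹' ·)).powerset,
        Finsupp.single (S ∩ ⋂₀ (K : Set (Set α))) ((-1) ^ K.card)) := fun ψ => by
    simp only [map_sum, Finsupp.linearCombination_single, inclusionExclusion]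
  rw [inclusionExclusion_image_right, heq]
  exact hf _ (heq φ ▸ h)

theorem isShiftPositive_of_tendsto {B κ : Type*} {φ : Set α → B → ℝ} {f : α → α} {l : Filter κ}
    [l.NeBot] (T : B → κ → (B → ℝ) →ₗ[ℝ] ℝ) (hT : ∀ b k g, 0 ≤ g → 0 ≤ T b k g)
    (hlim : ∀ b S, Tendsto (fun k => T b k (φ S)) l (𝓝 (φ (f '' S) b))) : IsShiftPositive φ f := by
  intro c hc b
  have hsum : Tendsto (fun k => T b k (Finsupp.linearCombination ℤ φ c)) l
      (𝓝 (Finsupp.linearCombination ℤ (fun S => φ (f '' S)) c b)) := by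
    simp only [Finsupp.linearCombination_apply, Finsupp.sum, map_sum, map_zsmul,
      Finset.sum_apply, Pi.smul_apply]
    exact tendsto_finsetSum _ fun S _ => (hlim b S).const_smul (c S)
  exact ge_of_tendsto' hsum fun k => hT b k _ hc

end InclusionExclusion

section Monoids

variable {M : Type*} [Monoid M]

/-- The principal right ideal generated by `r`. -/
def rightMultiples (r : M) : Set M := {m | r ∣ m}

theorem self_mem_rightMultiples (r : M) : r ∈ rightMultiples r := dvd_refl r

theorem rightMultiples_one : rightMultiples (1 : M) = Set.univ :=
  Set.eq_univ_of_forall one_dvd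

theorem image_mul_left_rightMultiples (x q : M) :
    (x * ·) '' rightMultiples q = rightMultiples (x * q) := by
  ext m
  simp only [rightMultiples, Dvd.dvd, Set.mem_image, Set.mem_ofPred_eq, mul_assoc]
  constructor
  · rintro ⟨_, ⟨c, rfl⟩, rfl⟩
    exact ⟨c, rfl⟩
  · rintro ⟨c, rfl⟩
    exact ⟨q * c, ⟨c, rfl⟩, rfl⟩

theorem image_mul_left_univ (x : M) : (x * ·) '' Set.univ = rightMultiples x := by
  rw [← rightMultiples_one, image_mul_left_rightMultiples, mul_one]

theorem isRightLCM_iff {U : Set M} {r : M} :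
    IsRightLCM U r ↔ ⋂ u ∈ U, rightMultiples u = rightMultiples r := by
  simp only [Set.ext_iff, Set.mem_iInter₂, rightMultiples, Set.mem_ofPred_eq]
  exact ⟨fun h m => ⟨h.2 m, fun hm u hu => (h.1 u hu).trans hm⟩,
    fun h => ⟨(h r).2 dvd_rfl, fun m hm => (h m).1 hm⟩⟩

theorem IsNoetherianMonoid.wellFounded (hN : IsNoetherianMonoid M) :
    WellFounded (IsProperFactor : M → M → Prop) := by
  rw [wellFounded_iff_isEmpty_descending_chain]
  exact ⟨fun f => hN ⟨f.1, f.2⟩⟩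

theorem isProperFactor_mul_left {x : M} (hx : ¬ IsUnit x) (q : M) : IsProperFactor q (x * q) :=
  ⟨x, 1, (mul_one _).symm, Or.inl hx⟩

theorem isProperFactor_mul_right {y : M} (hy : ¬ IsUnit y) (q : M) : IsProperFactor q (q * y) :=
  ⟨1, y, by rw [one_mul], Or.inr hy⟩

theorem IsNoetherianMonoid.exists_irreducible_mul (hN : IsNoetherianMonoid M) {p : M}
    (hp : ¬ IsUnit p) : ∃ x q, Irreducible x ∧ p = x * q := by
  induction p using hN.wellFounded.induction with
  | _ p ih =>
    by_cases hirr : Irreducible p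
    · exact ⟨p, 1, hirr, (mul_one p).symm⟩
    · rw [irreducible_iff] at hirr
      push Not at hirr
      obtain ⟨g, h, rfl, hg, hh⟩ := hirr hp
      obtain ⟨x, q, hx, rfl⟩ := ih g (isProperFactor_mul_right hh g) hg
      exact ⟨x, q * h, hx, mul_assoc x q h⟩

/-- The principal right ideals with generator in `R`, together with the empty set: intersecting
`pM` and `qM` gives `∅` when `p ∨ q = ∞`. -/
def idealFamily (R : Set M) : Set (Set M) := insert ∅ (rightMultiples '' R)

variable [IsLeftCancelMul M]

theorem preimage_rightMultiples_mul (x q : M) :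
    (x * ·) ⁻¹' rightMultiples (x * q) = rightMultiples q := by
  rw [← image_mul_left_rightMultiples, Set.preimage_image_eq _ (mul_right_injective x)]

theorem preimage_rightMultiples (hlcm : ∀ p q : M, (∃ r, p ∣ r ∧ q ∣ r) → ∃ r, IsRightLCM {p, q} r)
    (x p : M) : (x * ·) ⁻¹' rightMultiples p = ∅ ∨
      ∃ r, IsRightLCM {x, p} (x * r) ∧ (x * ·) ⁻¹' rightMultiples p = rightMultiples r := by
  refine (Set.eq_empty_or_nonempty _).imp_right ?_
  rintro ⟨m, hm⟩
  obtain ⟨s, hs⟩ := hlcm x p ⟨x * m, dvd_mul_right x m, hm⟩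
  obtain ⟨r, rfl⟩ := hs.1 x (Set.mem_insert x _)
  refine ⟨r, hs, ?_⟩
  rw [isRightLCM_iff, Set.biInter_pair] at hs
  rw [← preimage_rightMultiples_mul x r, ← hs, Set.preimage_inter, ← image_mul_left_univ x,
    Set.preimage_image_eq _ (mul_right_injective x), Set.univ_inter]

theorem preimage_mem_idealFamily_univ
    (hlcm : ∀ p q : M, (∃ r, p ∣ r ∧ q ∣ r) → ∃ r, IsRightLCM {p, q} r) (x : M) {C : Set M}
    (hC : C ∈ idealFamily Set.univ) : (x * ·) ⁻¹' C ∈ idealFamily (Set.univ : Set M) := by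
  obtain rfl | ⟨p, -, rfl⟩ := hC
  · exact Or.inl rfl
  · exact (preimage_rightMultiples hlcm x p).imp_right fun ⟨r, _, h⟩ => ⟨r, trivial, h.symm⟩

theorem preimage_mem_idealFamily_PInf
    (hlcm : ∀ p q : M, (∃ r, p ∣ r ∧ q ∣ r) → ∃ r, IsRightLCM {p, q} r) {x : M}
    (hx : Irreducible x) {C : Set M} (hC : C ∈ idealFamily (PInf M)) :
    (x * ·) ⁻¹' C ∈ idealFamily (PInf M) := by
  obtain rfl | ⟨p, hp, rfl⟩ := hC
  · exact Or.inl rfl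
  · exact (preimage_rightMultiples hlcm x p).imp_right fun ⟨r, hr, h⟩ =>
      ⟨r, MemPInf.step x p r hx hp hr, h.symm⟩

variable [Subsingleton Mˣ]

theorem rightMultiples_injective : Function.Injective (rightMultiples : M → Set M) := by
  intro r s h
  obtain ⟨c, rfl⟩ : r ∣ s := h.symm.subset (self_mem_rightMultiples s)
  obtain ⟨d, hd⟩ : r * c ∣ r := h.subset (self_mem_rightMultiples r)
  have hcd : c * d = 1 := mul_left_cancel (a := r) (by rw [mul_one, ← mul_assoc, ← hd])
  have hdc : d * c = 1 := mul_left_cancel (a := c) (by rw [mul_one, ← mul_assoc, hcd, one_mul])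
  have hc : c = 1 := Units.ext_iff.1 (Subsingleton.elim ⟨c, d, hcd, hdc⟩ (1 : Mˣ))
  rw [hc, mul_one]

end Monoids

section Reduction

variable {M : Type*} [Monoid M] [IsLeftCancelMul M] [Subsingleton Mˣ]
  {V : Type*} [AddCommGroup V] [PartialOrder V] [IsOrderedAddMonoid V] {φ : Set M → V}

open Classical in
/-- Peel an atom `x` off `p = x q`: removing `xM` instead of `pM` adds a generator from `PInf`, and
what remains lives in `xM`, where shifting back by `x` replaces `p` by its proper factor `q`. -/
theorem inclusionExclusion_insert_rightMultiples_nonneg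
    (hlcm : ∀ p q : M, (∃ r, p ∣ r ∧ q ∣ r) → ∃ r, IsRightLCM {p, q} r)
    (hN : IsNoetherianMonoid M) (hshift : ∀ x : M, Irreducible x → IsShiftPositive φ (x * ·))
    {n : ℕ}
    (ih : ∀ 𝒟 : Finset (Set M), ↑𝒟 ⊆ idealFamily (Set.univ : Set M) →
      ((𝒟 : Set (Set M)) \ idealFamily (PInf M)).encard ≤ n → 0 ≤ inclusionExclusion φ 𝒟 Set.univ)
    (p : M) (𝒟 : Finset (Set M)) (h𝒟 : ↑𝒟 ⊆ idealFamily (Set.univ : Set M))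
    (hn : ((𝒟 : Set (Set M)) \ idealFamily (PInf M)).encard ≤ n) :
    0 ≤ inclusionExclusion φ (insert (rightMultiples p) 𝒟) Set.univ := by
  induction p using hN.wellFounded.induction generalizing 𝒟 with
  | _ p ihp =>
    by_cases hp : IsUnit p
    · rw [isUnit_iff_eq_one.1 hp, rightMultiples_one,
        inclusionExclusion_insert_of_subset φ subset_rfl]
    obtain ⟨x, q, hx, rfl⟩ := hN.exists_irreducible_mul hp
    have hsub : rightMultiples (x * q) ⊆ rightMultiples x := fun m => (dvd_mul_right x q).trans
    have hxPInf : rightMultiples x ∈ idealFamily (PInf M) := Or.inr ⟨x, MemPInf.atom x hx, rfl⟩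
    rw [inclusionExclusion_insert_eq_add φ hsub, Set.univ_inter]
    refine add_nonneg (ih _ ?_ ?_) ?_
    · rw [Finset.coe_insert]
      exact Set.insert_subset (Or.inr ⟨x, trivial, rfl⟩) h𝒟
    · rwa [Finset.coe_insert, Set.insert_sdiff_of_mem _ hxPInf]
    · rw [← image_mul_left_univ x]
      refine (hshift x hx).inclusionExclusion_image_nonneg ?_
      rw [Finset.image_insert, preimage_rightMultiples_mul]
      refine ihp q (isProperFactor_mul_left hx.not_isUnit q) _ ?_ ?_
      · rw [Finset.coe_image, Set.image_subset_iff]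
        exact fun C hC => preimage_mem_idealFamily_univ hlcm x (h𝒟 hC)
      · refine (Set.encard_le_encard ?_).trans ((Set.encard_image_le ((x * ·) ⁻¹' ·) _).trans hn)
        rw [Finset.coe_image]
        rintro _ ⟨⟨C, hC, rfl⟩, hxC⟩
        exact ⟨C, ⟨hC, fun h => hxC (preimage_mem_idealFamily_PInf hlcm hx h)⟩, rfl⟩

theorem inclusionExclusion_nonneg_of_encard_le
    (hlcm : ∀ p q : M, (∃ r, p ∣ r ∧ q ∣ r) → ∃ r, IsRightLCM {p, q} r)
    (hN : IsNoetherianMonoid M) (hshift : ∀ x : M, Irreducible x → IsShiftPositive φ (x * ·))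
    (hpos : ∀ 𝒟 : Finset (Set M), ↑𝒟 ⊆ idealFamily (PInf M) →
      0 ≤ inclusionExclusion φ 𝒟 Set.univ) (n : ℕ)
    (𝒟 : Finset (Set M)) (h𝒟 : ↑𝒟 ⊆ idealFamily (Set.univ : Set M))
    (hn : ((𝒟 : Set (Set M)) \ idealFamily (PInf M)).encard ≤ n) :
    0 ≤ inclusionExclusion φ 𝒟 Set.univ := by
  classical
  induction n generalizing 𝒟 with
  | zero =>
    rw [Nat.cast_zero, nonpos_iff_eq_zero, Set.encard_eq_zero, Set.sdiff_eq_empty] at hn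
    exact hpos 𝒟 hn
  | succ n ih =>
    by_cases h𝒟' : ↑𝒟 ⊆ idealFamily (PInf M)
    · exact hpos 𝒟 h𝒟'
    obtain ⟨C, hC𝒟, hC⟩ := Set.not_subset.1 h𝒟'
    obtain ⟨p, -, rfl⟩ := (h𝒟 hC𝒟).resolve_left fun h => hC (Or.inl h)
    have hCdiff : rightMultiples p ∈ (𝒟 : Set (Set M)) \ idealFamily (PInf M) := ⟨hC𝒟, hC⟩
    have hcard : (((𝒟.erase (rightMultiples p) : Finset (Set M)) : Set (Set M)) \
        idealFamily (PInf M)).encard ≤ n := by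
      rw [← Set.encard_sdiff_singleton_add_one hCdiff, Nat.cast_succ] at hn
      rw [Finset.coe_erase, sdiff_right_comm]
      exact (ENat.add_le_add_iff_right ENat.one_ne_top).1 hn
    rw [← Finset.insert_erase hC𝒟]
    exact inclusionExclusion_insert_rightMultiples_nonneg hlcm hN hshift ih p _
      ((Finset.coe_subset.2 (Finset.erase_subset _ _)).trans h𝒟) hcard

open Classical in
theorem inclusionExclusion_nonneg_of_PInf
    (hlcm : ∀ p q : M, (∃ r, p ∣ r ∧ q ∣ r) → ∃ r, IsRightLCM {p, q} r)
    (hN : IsNoetherianMonoid M) (hφ : φ ∅ = 0)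
    (hshift : ∀ x : M, Irreducible x → IsShiftPositive φ (x * ·))
    (hpos : ∀ J : Finset M, ↑J ⊆ PInf M →
      0 ≤ inclusionExclusion φ (J.image rightMultiples) Set.univ) (J : Finset M) :
    0 ≤ inclusionExclusion φ (J.image rightMultiples) Set.univ := by
  have hfamily : ∀ 𝒟 : Finset (Set M), ↑𝒟 ⊆ idealFamily (PInf M) →
      0 ≤ inclusionExclusion φ 𝒟 Set.univ := fun 𝒟 h𝒟 => by
    have herase : (↑(𝒟.erase ∅) : Set (Set M)) ⊆ rightMultiples '' PInf M := by
      rwa [Finset.coe_erase, Set.sdiff_singleton_subset_iff]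
    obtain ⟨J, hJ, hJ𝒟⟩ := Finset.subset_set_image_iff.1 herase
    rw [← inclusionExclusion_erase_empty hφ, ← hJ𝒟]
    exact hpos J hJ
  obtain ⟨n, hn⟩ := ((J.image rightMultiples).finite_toSet.sdiff
    (t := idealFamily (PInf M))).exists_encard_eq_coe
  refine inclusionExclusion_nonneg_of_encard_le hlcm hN hshift hfamily n _ ?_ hn.le
  rw [Finset.coe_image]
  exact (Set.image_mono (Set.subset_univ _)).trans (Set.subset_insert _ _)

end Reduction

section Transfer

variable {A : Type*} [NonUnitalCStarAlgebra A] [PartialOrder A]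
  {M : Type*} [Monoid M]
  {X : M → Type*} [∀ p, NormedAddCommGroup (X p)] [∀ p, NormedSpace ℂ (X p)]
  [∀ p, CompleteSpace (X p)] [∀ p, CStarCorrespondence A (X p)]
  {N : M →* ℝ} {β : ℝ} {σ : A → ℝ≥0∞}

variable (X N β) in
/-- The weight `N(p)^{-β} Tr_σ^p`. -/
noncomputable def transfer (p : M) (σ : A → ℝ≥0∞) (a : A) : ℝ≥0∞ :=
  ENNReal.ofReal (N p ^ (-β)) * inducedWeight (X p) σ a

theorem ProductSystem.lact_mul_eq (Y : ProductSystem A X) {p q r : M} (h : p * q = r) (a : A)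
    (x : X p) (y : X q) : lact a (Y.mul h x y) = Y.mul h (lact a x) y := by
  rw [← Y.unit_mul, ← Y.unit_mul, Y.mul_assoc (one_mul p) h h (one_mul r)]

variable [StarOrderedRing A]

theorem transfer_mono {σ' : A → ℝ≥0∞} (h : ∀ a, 0 ≤ a → σ a ≤ σ' a) (p : M) {a : A} (ha : 0 ≤ a) :
    transfer X N β p σ a ≤ transfer X N β p σ' a :=
  mul_le_mul_right (inducedWeight_mono h ha) _

theorem ProductSystem.transfer_one (Y : ProductSystem A X) (hσ : IsBoundedTrace σ) {a : A}
    (ha : 0 ≤ a) : transfer X N β 1 σ a = σ a := by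
  rw [transfer, map_one, Real.one_rpow, ENNReal.ofReal_one, one_mul,
    inducedWeight_eq_of_linearEquiv hσ Y.unit Y.ip_unit Y.lact_unit ha]

theorem isBoundedTrace_inducedWeight_of_transfer_le {p : M} (hN : 0 < N p) (hσ : IsBoundedTrace σ)
    (hle : ∀ a, 0 ≤ a → transfer X N β p σ a ≤ σ a) : IsBoundedTrace (inducedWeight (X p) σ) := by
  obtain ⟨C, hC⟩ := hσ.bound
  have hc : ENNReal.ofReal (N p ^ (-β)) ≠ 0 := by simpa using Real.rpow_pos_of_pos hN _
  refine hσ.inducedWeight ⟨((N p ^ (-β)).toNNReal)⁻¹ * C, fun a ha => ?_⟩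
  rw [ENNReal.coe_mul, ENNReal.coe_inv (by simpa [ENNReal.ofReal] using hc), mul_assoc]
  exact (ENNReal.mul_le_iff_le_inv hc ENNReal.ofReal_ne_top).1 ((hle a ha).trans (hC a ha))

theorem IsBoundedTrace.transfer {p : M} (hN : 0 < N p) (hσ : IsBoundedTrace σ)
    (hle : ∀ a, 0 ≤ a → transfer X N β p σ a ≤ σ a) : IsBoundedTrace (transfer X N β p σ) where
  add a b ha hb := by
    have h := isBoundedTrace_inducedWeight_of_transfer_le hN hσ hle
    simp only [_root_.transfer, h.add a b ha hb, mul_add]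
  trace c := by
    have h := isBoundedTrace_inducedWeight_of_transfer_le hN hσ hle
    simp only [_root_.transfer, h.trace c]
  bound := hσ.bound.imp fun _ hC a ha => (hle a ha).trans (hC a ha)

namespace ProductSystem

theorem transfer_mul (Y : ProductSystem A X) (hN : ∀ p, 0 < N p) (hσ : IsBoundedTrace σ) {x : M}
    (hx : x ≠ 1) {q : M} (hle : ∀ a, 0 ≤ a → transfer X N β q σ a ≤ σ a) {a : A} (ha : 0 ≤ a) :
    transfer X N β (x * q) σ a = transfer X N β x (transfer X N β q σ) a := by
  have hq := isBoundedTrace_inducedWeight_of_transfer_le (hN q) hσ hle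
  have hfun : transfer X N β q σ =
      fun b => ENNReal.ofReal (N q ^ (-β)) * inducedWeight (X q) σ b := rfl
  rw [hfun, transfer, transfer, inducedWeight_const_mul, ← _root_.mul_assoc,
    ← ENNReal.ofReal_mul (Real.rpow_nonneg (hN x).le _), ← Real.mul_rpow (hN x).le (hN q).le,
    ← map_mul, (Y.isTensor rfl hx).inducedWeight_eq (Y.lact_mul_eq rfl) hσ hq ha]

theorem transfer_le_of_irreducible [Subsingleton Mˣ] (Y : ProductSystem A X)
    (hNoeth : IsNoetherianMonoid M) (hN : ∀ p, 0 < N p) (hσ : IsBoundedTrace σ)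
    (hirr : ∀ x : M, Irreducible x → ∀ a, 0 ≤ a → transfer X N β x σ a ≤ σ a) (p : M) :
    ∀ a, 0 ≤ a → transfer X N β p σ a ≤ σ a := by
  induction p using hNoeth.wellFounded.induction with
  | _ p ih =>
    intro a ha
    by_cases hp : IsUnit p
    · rw [isUnit_iff_eq_one.1 hp, Y.transfer_one hσ ha]
    obtain ⟨x, q, hx, rfl⟩ := hNoeth.exists_irreducible_mul hp
    have hq := ih q (isProperFactor_mul_left hx.not_isUnit q)
    calc transfer X N β (x * q) σ a
        = transfer X N β x (transfer X N β q σ) a := Y.transfer_mul hN hσ hx.ne_one hq ha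
      _ ≤ transfer X N β x σ a := transfer_mono hq x ha
      _ ≤ σ a := hirr x hx a ha

end ProductSystem

end Transfer

section IdealWeight

variable {A : Type*} [NonUnitalCStarAlgebra A] [PartialOrder A]
  {M : Type*} [Monoid M]
  {X : M → Type*} [∀ p, NormedAddCommGroup (X p)] [∀ p, NormedSpace ℂ (X p)]
  [∀ p, CompleteSpace (X p)] [∀ p, CStarCorrespondence A (X p)]
  {N : M →* ℝ} {β : ℝ} {σ : A → ℝ≥0∞}

variable (X N β) in
/-- The weight-valued set function with value `N(p)^{-β} Tr_σ^p` at the ideal `pM`, extended by zero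
to all subsets of `M`. -/
noncomputable def idealWeight (σ : A → ℝ≥0∞) : Set M → A → ℝ≥0∞ :=
  Function.extend rightMultiples (fun p => transfer X N β p σ) 0

variable (X N β) in
/-- The set function `idealWeight`, viewed as real-valued on the positive cone. -/
noncomputable def coneWeight (σ : A → ℝ≥0∞) (S : Set M) (a : {a : A // 0 ≤ a}) : ℝ :=
  (idealWeight X N β σ S a).toReal

theorem idealWeight_of_notMem_range {S : Set M}
    (hS : S ∉ Set.range (rightMultiples : M → Set M)) : idealWeight X N β σ S = 0 :=
  Function.extend_apply' _ _ _ hS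

theorem coneWeight_empty : coneWeight X N β σ ∅ = 0 := by
  have hS : ∅ ∉ Set.range (rightMultiples : M → Set M) := fun ⟨r, hr⟩ =>
    hr.subset (self_mem_rightMultiples r)
  ext a
  simp [coneWeight, idealWeight_of_notMem_range hS]

variable [IsLeftCancelMul M] [Subsingleton Mˣ]

theorem idealWeight_rightMultiples (p : M) :
    idealWeight X N β σ (rightMultiples p) = transfer X N β p σ :=
  rightMultiples_injective.extend_apply _ _ p

variable [StarOrderedRing A]

theorem isBoundedTrace_idealWeight (hN : ∀ p, 0 < N p) (hσ : IsBoundedTrace σ)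
    (hle : ∀ p a, 0 ≤ a → transfer X N β p σ a ≤ σ a) (S : Set M) :
    IsBoundedTrace (idealWeight X N β σ S) := by
  by_cases hS : S ∈ Set.range (rightMultiples : M → Set M)
  · obtain ⟨p, rfl⟩ := hS
    rw [idealWeight_rightMultiples]
    exact hσ.transfer (hN p) (hle p)
  · rw [idealWeight_of_notMem_range hS]
    exact ⟨by simp, by simp, 0, by simp⟩

theorem ProductSystem.transfer_idealWeight (Y : ProductSystem A X) (hN : ∀ p, 0 < N p)
    (hσ : IsBoundedTrace σ) (hle : ∀ p a, 0 ≤ a → transfer X N β p σ a ≤ σ a) {x : M} (hx : x ≠ 1)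
    (S : Set M) {a : A} (ha : 0 ≤ a) :
    transfer X N β x (idealWeight X N β σ S) a = idealWeight X N β σ ((x * ·) '' S) a := by
  by_cases hS : S ∈ Set.range (rightMultiples : M → Set M)
  · obtain ⟨q, rfl⟩ := hS
    rw [image_mul_left_rightMultiples, idealWeight_rightMultiples, idealWeight_rightMultiples,
      Y.transfer_mul hN hσ hx (hle q) ha]
  · have hxS : (x * ·) '' S ∉ Set.range (rightMultiples : M → Set M) := by
      rintro ⟨t, ht⟩
      obtain ⟨q, -, rfl⟩ : t ∈ (x * ·) '' S := ht ▸ self_mem_rightMultiples t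
      refine hS ⟨q, (mul_right_injective x).image_injective ?_⟩
      exact (image_mul_left_rightMultiples x q).trans ht
    simp [idealWeight_of_notMem_range hS, idealWeight_of_notMem_range hxS, transfer, inducedWeight]

theorem ProductSystem.isShiftPositive_coneWeight (Y : ProductSystem A X) (hN : ∀ p, 0 < N p)
    (hσ : IsBoundedTrace σ) (hle : ∀ p a, 0 ≤ a → transfer X N β p σ a ≤ σ a) {x : M}
    (hx : x ≠ 1) : IsShiftPositive (coneWeight X N β σ) (x * ·) := by
  classical
  let T (a : {a : A // 0 ≤ a}) (k : Finset (X x) × ℕ) : ({a : A // 0 ≤ a} → ℝ) →ₗ[ℝ] ℝ :=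
    N x ^ (-β) • ∑ ξ ∈ approxFrame A k, LinearMap.proj ⟨ip ξ (lact a.1 ξ), ip_lact_nonneg a.2 ξ⟩
  have hT : ∀ a k g, T a k g =
      N x ^ (-β) * ∑ ξ ∈ approxFrame A k, g ⟨ip ξ (lact a.1 ξ), ip_lact_nonneg a.2 ξ⟩ :=
    fun a k g => by simp [T, LinearMap.sum_apply]
  have hc : 0 ≤ N x ^ (-β) := Real.rpow_nonneg (hN x).le _
  refine isShiftPositive_of_tendsto (l := atTop) T (fun a k g hg => ?_) fun a S => ?_
  · rw [hT]
    exact mul_nonneg hc (Finset.sum_nonneg fun ξ _ => hg _)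
  have hS := isBoundedTrace_idealWeight hN hσ hle S
  have hxS := isBoundedTrace_idealWeight hN hσ hle ((x * ·) '' S)
  have hlim := ENNReal.Tendsto.const_mul (hS.tendsto_inducedWeight
    (isApproxFrame_approxFrame (E := X x)) a.2) (Or.inr (ENNReal.ofReal_ne_top (r := N x ^ (-β))))
  rw [← transfer, Y.transfer_idealWeight hN hσ hle hx S a.2] at hlim
  refine ((ENNReal.tendsto_toReal (hxS.ne_top a.2)).comp hlim).congr fun k => ?_
  rw [hT, Function.comp_apply, ENNReal.toReal_mul, ENNReal.toReal_ofReal hc,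
    ENNReal.toReal_sum fun ξ _ => hS.ne_top (ip_lact_nonneg a.2 _)]
  rfl

end IdealWeight

section Positivity

variable {A : Type*} [NonUnitalCStarAlgebra A] [PartialOrder A] [StarOrderedRing A]
  {M : Type*} [Monoid M] [IsLeftCancelMul M] [Subsingleton Mˣ]
  {X : M → Type*} [∀ p, NormedAddCommGroup (X p)] [∀ p, NormedSpace ℂ (X p)]
  [∀ p, CompleteSpace (X p)] [∀ p, CStarCorrespondence A (X p)]
  {N : M →* ℝ} {β : ℝ} {τ : A →L[ℂ] ℂ}

theorem joinTerm_eq_idealWeight (hpos : ∀ a, 0 ≤ a → 0 ≤ τ a) {a : A} (ha : 0 ≤ a) (K : Finset M) :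
    joinTerm X N β τ a K =
      idealWeight X N β (traceWeight τ) (⋂ k ∈ K, rightMultiples k) a := by
  by_cases h : ∃ r, IsRightLCM (K : Set M) r
  · have hr : ⋂ k ∈ K, rightMultiples k = rightMultiples h.choose := isRightLCM_iff.1 h.choose_spec
    rw [joinTerm, dif_pos h, hr, idealWeight_rightMultiples, transfer, inducedTrace_lact_eq hpos ha]
  · rw [joinTerm, dif_neg h, idealWeight_of_notMem_range, Pi.zero_apply]
    exact fun ⟨r, hr⟩ => h ⟨r, isRightLCM_iff.2 hr.symm⟩

theorem PositivityOn.transfer_le {R : Set M} (h : PositivityOn X N β τ R)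
    (hpos : ∀ a, 0 ≤ a → 0 ≤ τ a) {p : M} (hp : p ∈ R) (a : A) (ha : 0 ≤ a) :
    transfer X N β p (traceWeight τ) a ≤ traceWeight τ a := by
  have hjoin : joinTerm X N β τ a {p} = transfer X N β p (traceWeight τ) a := by
    rw [joinTerm_eq_idealWeight hpos ha, Finset.set_biInter_singleton, idealWeight_rightMultiples]
  have hset : ({p} : Finset M).powerset.filter (fun K => K.Nonempty) = {{p}} := by
    ext K
    simp only [Finset.mem_filter, Finset.mem_powerset, Finset.mem_singleton]
    refine ⟨fun hK => hK.2.subset_singleton_iff.1 hK.1, ?_⟩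
    rintro rfl
    exact ⟨subset_rfl, Finset.singleton_nonempty p⟩
  have hsum := h {p} (by simpa using hp) a ha
  rw [positivitySum, hset, Finset.sum_singleton, Finset.card_singleton, pow_one, neg_one_mul,
    ← sub_eq_add_neg, hjoin] at hsum
  by_cases htop : transfer X N β p (traceWeight τ) a = ⊤
  · simp [htop] at hsum
  rw [← EReal.coe_ennreal_toReal htop, ← EReal.coe_sub, EReal.coe_nonneg, sub_nonneg] at hsum
  rw [← ENNReal.ofReal_toReal htop]
  exact ENNReal.ofReal_le_ofReal hsum

open Classical in
theorem ProductSystem.positivitySum_eq (Y : ProductSystem A X) (hN : ∀ p, 0 < N p)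
    (hpos : ∀ a, 0 ≤ a → 0 ≤ τ a) (hτ : IsBoundedTrace (traceWeight τ))
    (hle : ∀ p a, 0 ≤ a → transfer X N β p (traceWeight τ) a ≤ traceWeight τ a) (J : Finset M)
    {a : A} (ha : 0 ≤ a) :
    positivitySum X N β τ J a = (inclusionExclusion (coneWeight X N β (traceWeight τ))
      (J.image rightMultiples) Set.univ ⟨a, ha⟩ : ℝ) := by
  have hterm : ∀ K, (joinTerm X N β τ a K : EReal) =
      (coneWeight X N β (traceWeight τ) (⋂ k ∈ K, rightMultiples k) ⟨a, ha⟩ : ℝ) := fun K => by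
    rw [joinTerm_eq_idealWeight hpos ha, coneWeight,
      EReal.coe_ennreal_toReal ((isBoundedTrace_idealWeight hN hτ hle _).ne_top ha)]
  have hempty : coneWeight X N β (traceWeight τ)
      (⋂ k ∈ (∅ : Finset M), rightMultiples k) ⟨a, ha⟩ = (τ a).re := by
    have huniv : ⋂ k ∈ (∅ : Finset M), rightMultiples k = rightMultiples 1 := by
      simp [rightMultiples_one]
    rw [huniv, coneWeight, idealWeight_rightMultiples,
      Y.transfer_one hτ ha, traceWeight, ENNReal.toReal_ofReal (Complex.le_def.1 (hpos a ha)).1]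
  have hfilter : J.powerset.filter (fun K => K.Nonempty) = J.powerset.erase ∅ := by
    simp only [Finset.nonempty_iff_ne_empty, Finset.filter_ne']
  have hcoe := map_sum (⟨⟨Real.toEReal, EReal.coe_zero⟩, EReal.coe_add⟩ : ℝ →+ EReal)
    (fun K => (-1) ^ K.card * coneWeight X N β (traceWeight τ) (⋂ k ∈ K, rightMultiples k) ⟨a, ha⟩)
    (J.powerset.erase ∅)
  simp only [AddMonoidHom.coe_mk, ZeroHom.coe_mk, EReal.coe_mul, EReal.coe_pow, EReal.coe_neg,
    EReal.coe_one] at hcoe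
  simp only [positivitySum, hfilter, hterm]
  rw [← hcoe, inclusionExclusion_image _ rightMultiples_injective, Finset.sum_apply,
    ← Finset.add_sum_erase _ _ (Finset.empty_mem_powerset J), ← EReal.coe_add]
  simp only [Set.univ_inter, Pi.smul_apply, zsmul_eq_mul, Int.cast_pow, Int.cast_neg, Int.cast_one,
    hempty, Finset.card_empty, pow_zero, one_mul]

open Classical in
theorem ProductSystem.positivityOn_iff (Y : ProductSystem A X) (hN : ∀ p, 0 < N p)
    (hpos : ∀ a, 0 ≤ a → 0 ≤ τ a) (hτ : IsBoundedTrace (traceWeight τ))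
    (hle : ∀ p a, 0 ≤ a → transfer X N β p (traceWeight τ) a ≤ traceWeight τ a) (R : Set M) :
    PositivityOn X N β τ R ↔ ∀ J : Finset M, ↑J ⊆ R →
      0 ≤ inclusionExclusion (coneWeight X N β (traceWeight τ)) (J.image rightMultiples) Set.univ :=
  forall₂_congr fun J _ => by
    simp only [Pi.le_def, Subtype.forall, Pi.zero_apply]
    exact forall₂_congr fun a ha => by
      rw [Y.positivitySum_eq hN hpos hτ hle J ha, EReal.coe_nonneg]

end Positivity

theorem mainTheorem5_general {M : Type*} [Monoid M] [IsLeftCancelMul M] [Subsingleton Mˣ]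
    (hlcm : ∀ p q : M, (∃ r, p ∣ r ∧ q ∣ r) → ∃ r, IsRightLCM {p, q} r)
    (hNoeth : IsNoetherianMonoid M)
    {A : Type*} [NonUnitalCStarAlgebra A] [PartialOrder A] [StarOrderedRing A]
    {X : M → Type*} [∀ p, NormedAddCommGroup (X p)] [∀ p, NormedSpace ℂ (X p)]
    [∀ p, CompleteSpace (X p)] [∀ p, CStarCorrespondence A (X p)] (Y : ProductSystem A X)
    {N : M →* ℝ} (hN : ∀ p, 0 < N p) (β : ℝ) {τ : A →L[ℂ] ℂ}
    (hpos : ∀ a, 0 ≤ a → 0 ≤ τ a) (htr : ∀ a b, τ (a * b) = τ (b * a)) :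
    PositivityOn X N β τ {p | p ≠ 1} ↔ PositivityOn X N β τ (PInf M) := by
  classical
  have hτ := isBoundedTrace_traceWeight hpos htr
  constructor <;> intro h
  · have hle := Y.transfer_le_of_irreducible hNoeth hN hτ fun x hx => h.transfer_le hpos hx.ne_one
    rw [Y.positivityOn_iff hN hpos hτ hle] at h ⊢
    intro J _
    by_cases hJ : (1 : M) ∈ J
    · rw [← Finset.insert_erase hJ, Finset.image_insert,
        inclusionExclusion_insert_of_subset _ rightMultiples_one.superset]
    · exact h J fun p hp hp1 => hJ (hp1 ▸ hp)
  · have hle := Y.transfer_le_of_irreducible hNoeth hN hτ fun x hx =>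
      h.transfer_le hpos (MemPInf.atom x hx)
    rw [Y.positivityOn_iff hN hpos hτ hle] at h ⊢
    exact fun J _ => inclusionExclusion_nonneg_of_PInf hlcm hNoeth coneWeight_empty
      (fun x hx => Y.isShiftPositive_coneWeight hN hτ hle hx.ne_one) h J

theorem IsWeakQuasiLatticeOrdered.subsingleton_units {G : Type*} [Group G] {P : Submonoid G}
    (hP : IsWeakQuasiLatticeOrdered P) : Subsingleton Pˣ := by
  refine subsingleton_of_forall_eq 1 fun u => Units.ext (Subtype.ext ?_)
  have hinv : ((u : P) : G)⁻¹ = ((u⁻¹ : Pˣ) : P) :=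
    inv_eq_of_mul_eq_one_right (congrArg Subtype.val u.mul_inv)
  exact hP.inter_inv _ (u : P).2 (hinv ▸ ((u⁻¹ : Pˣ) : P).2)

theorem mainTheorem5 {G : Type*} [Group G] (P : Submonoid G)
    (hP : IsWeakQuasiLatticeOrdered P) (hNoeth : IsNoetherianMonoid P)
    {A : Type*} [NonUnitalCStarAlgebra A] [PartialOrder A] [StarOrderedRing A]
    (X : P → Type*) [∀ p, NormedAddCommGroup (X p)] [∀ p, NormedSpace ℂ (X p)]
    [∀ p, CompleteSpace (X p)] [∀ p, CStarCorrespondence A (X p)]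
    (Y : ProductSystem A X) (hess : ∀ p, IsEssential A (X p)) (hca : Y.IsCompactlyAligned)
    (N : P →* ℝ) (hN : ∀ p, 0 < N p) (β : ℝ)
    (τ : A →L[ℂ] ℂ) (hτ : IsTracialState τ) :
    PositivityOn X N β τ {p : P | p ≠ 1} ↔ PositivityOn X N β τ (PInf P) := by
  have := hP.subsingleton_units
  exact mainTheorem5_general hP.exists_lcm hNoeth Y hN β hτ.nonneg hτ.tracial
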